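/- **Setting.** Let $1<Q<2$, let $t\in(0,1)$ satisfy $\ln 2/\ln(1/t)=Q-1$, let $j\ge 1$ be the integer with $\frac1{j+1}<t\le\frac1j$, and let $j_1,j_2,\ldots\in\{j,j+1\}$ satisfy $\frac{j}{j+1}\prod_{i=1}^m j_i^{-1}\le t^m\le\frac{j+1}{j}\prod_{i=1}^m j_i^{-1}$ for all $m$. Let $K\subset[0,1]$ be the Cantor set with $K=tK\cup(tK+1-t)$; for a finite $0$-$1$ word $a$ let $K_a$ be its cell with address $a$ ($K_\emptyset=K$, $K_{0a}=tK_a$, $K_{1a}=tK_a+1-t$), whose level is the length $|a|$; let $\nu$ be the Bernoulli probability measure on $K$, which gives each cell of level $n$ mass $2^{-n}$. For $l\ge1$ the wormholes of level $l$ are located at the numbers $\sum_{i=1}^l m_i\prod_{h=1}^i j_h^{-1}$ with integers $0\le m_i<j_i$ for $i<l$ and $0<m_l<j_l$. The Laakso space $L$ is the quotient (with identification map $\iota$ and the quotient topology) of $[0,1]\times K$ by the equivalence relation generated by $(x,w)\sim(x,w+t^{l-1}(1-t))$ whenever $l\ge1$, $x$ is a wormhole location of level $l$, and $w\in K_{a0}$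 with $|a|=l-1$ (so that $w+t^{l-1}(1-t)\in K_{a1}$). Let $\mu$ be the image under $\iota$ of Lebesgue measure times $\nu$. The length of a curve in $L$ is the total variation of its $[0,1]$-coordinate (the geodesic metric of $L$ is the infimum of the lengths of connecting curves). **Upper gradients.** A Borel function $g:L\to[0,\infty]$ is an upper gradient of $f:L\to\mathbb R$ if $|f(x)-f(y)|\le\int_\gamma g\,dm$ for all $x,y\in L$ and all rectifiable curves $\gamma$ from $x$ to $y$, $dm$ being arc length. In the sense of Cheeger, $p\in L^2(\mu)$ is a generalized upper gradient of $u\in L^2(\mu)$ if there are $f_n\to u$ and $g_n\to p$ in $L^2(\mu)$ with $g_n$ an upper gradient of $f_n$; it is the minimal one, written $p_u$, if moreover $p\le q$ $\mu$-a.e. for each generalized upper gradient $q\in L^2(\mu)$ of $u$. Let $H^{1,2}$ be the set of $u\in L^2(\mu)$ for which $p_u$ exists, with the graph norm $\|u\|_{L^2}+\|p_u\|_{L^2}$. **Smooth class.** For $f\in C(L)$ put $\hat f=f\circ\iota$. Let $\mathcal G=\bigcup_{n\ge0}\mathcal G_n$, where $f\in C(L)$ belongs to $\mathcal G_n$ if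 $\hat f(x,\cdot)$ is constant on each cell of level $n$ for every $x$, and, for every $w\in K$, $\hat f(\cdot,w)$ is continuously differentiable on each open interval between neighbouring points of the set consisting of $0$, $1$ and the wormhole locations of level at most $n$, the derivative having finite one-sided limits at the endpoints of these intervals. For $f\in\mathcal G$, $\frac{\partial f}{\partial x}\in L^2(\mu)$ is given a.e. by $\frac{\partial f}{\partial x}\circ\iota=\frac{\partial\hat f}{\partial x}$. Let $\mathrm{Dom}(\mathcal E)=\overline{\mathcal G}$ be the closure of $\mathcal G$ in $H^{1,2}$ for the graph norm: the set of $u\in H^{1,2}$ for which there are $f_n\in\mathcal G$ with $\|u-f_n\|_{L^2}+\|p_{u-f_n}\|_{L^2}\to0$. For $u\in\overline{\mathcal G}$ let $\frac{\partial u}{\partial x}$ be the $L^2$-limit of $\frac{\partial f_n}{\partial x}$ for a sequence $f_n\in\mathcal G$ converging to $u$ in the graph norm along which this limit exists. **Claim.** For every $u\in\overline{\mathcal G}$ the derivative $\frac{\partial u}{\partial x}\in L^2(\mu)$ exists and is uniquely determined, and, with $\mathcal E(u,v)=\int_L\frac{\partial u}{\partial x}\frac{\partial v}{\partial x}\,d\mu$,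 $$\mathcal E(u,u)=\int_L p_u^2\,d\mu=\int_L\Big(\frac{\partial u}{\partial x}\Big)^2d\mu .$$ Moreover $(\mathcal E,\overline{\mathcal G})$ is a Dirichlet form on $L^2(L,\mu)$: $\overline{\mathcal G}$ is a dense linear subspace of $L^2(L,\mu)$; $\mathcal E$ is a nonnegative symmetric bilinear form on it; $\mathcal E$ is closed, that is, $\overline{\mathcal G}$ is complete for the norm $(\mathcal E(u,u)+\|u\|_{L^2}^2)^{1/2}$; and $\mathcal E$ is Markovian: for $u\in\overline{\mathcal G}$ one has $(u\vee0)\wedge1\in\overline{\mathcal G}$ and $\mathcal E((u\vee0)\wedge1,(u\vee0)\wedge1)\le\mathcal E(u,u)$. -/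

import Mathlib

open MeasureTheory Set Filter Topology
open scoped ENNReal

noncomputable section

namespace LaaksoSpace

/-- The parameters of a Laakso space built from one Cantor set: the dimension `Q ∈ (1, 2)`, the
contraction ratio `t` of the Cantor set of dimension `Q - 1`, the integer `j` with
`1 / (j + 1) < t ≤ 1 / j`, and a sequence `js 1, js 2, …` in `{j, j + 1}` whose partial products
follow the powers of `t` (the value `js 0` plays no role). -/
structure Data where
  Q : ℝ
  t : ℝ
  j : ℕ
  js : ℕ → ℕ
  one_lt_Q : 1 < Q
  Q_lt_two : Q < 2
  t_pos : 0 < t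
  t_lt_one : t < 1
  dim_eq : Real.log 2 / Real.log (1 / t) = Q - 1
  one_le_j : 1 ≤ j
  lt_t : 1 / ((j : ℝ) + 1) < t
  t_le : t ≤ 1 / (j : ℝ)
  js_mem : ∀ i, 1 ≤ i → js i = j ∨ js i = j + 1
  lower : ∀ m : ℕ, (j : ℝ) / (j + 1) * ∏ i ∈ Finset.Icc 1 m, (js i : ℝ)⁻¹ ≤ t ^ m
  upper : ∀ m : ℕ, t ^ m ≤ ((j : ℝ) + 1) / j * ∏ i ∈ Finset.Icc 1 m, (js i : ℝ)⁻¹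

variable (D : Data)

/-! ### The Cantor set, its cells and its Bernoulli measure -/

/-- The point of the Cantor set of ratio `t` with infinite address `a`. -/
def cantorPoint (a : ℕ → Bool) : ℝ :=
  ∑' i : ℕ, if a i then D.t ^ i * (1 - D.t) else 0

/-- The Cantor set `K ⊆ [0, 1]`, that is the nonempty compact set with
`K = t K ∪ (t K + 1 - t)`. -/
def cantor : Set ℝ := range (cantorPoint D)

/-- The contractions `x ↦ t x` and `x ↦ t x + 1 - t`. -/
def contraction (b : Bool) (x : ℝ) : ℝ :=
  if b then D.t * x + (1 - D.t) else D.t * x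

/-- The cell `K_a` of the Cantor set with finite address `a`; its level is the length of `a`. -/
def cell : List Bool → Set ℝ
  | [] => cantor D
  | b :: a => contraction D b '' cell a

lemma continuous_cantorPoint : Continuous (cantorPoint D) := by
  have ht := D.t_pos
  have ht1 := D.t_lt_one
  refine continuous_tsum (u := fun i => D.t ^ i * (1 - D.t)) ?_ ?_ ?_
  · intro i
    exact (continuous_of_discreteTopology
      (f := fun b : Bool => if b then D.t ^ i * (1 - D.t) else 0)).comp (continuous_apply i)
  · exact (summable_geometric_of_lt_one ht.le ht1).mul_right _
  · intro i a
    have h : 0 ≤ D.t ^ i * (1 - D.t) := mul_nonneg (pow_nonneg ht.le i) (by linarith)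
    split_ifs
    · rw [Real.norm_eq_abs, abs_of_nonneg h]
    · simpa using h

instance : CompactSpace (cantor D) :=
  isCompact_iff_compactSpace.mp (isCompact_range (continuous_cantorPoint D))

/-- The Bernoulli measure on `K`: the law of the point whose address is a sequence of independent
fair coin tosses. -/
def cantorMeasure : Measure (cantor D) :=
  (Measure.infinitePi fun _ : ℕ => (PMF.uniformOfFintype Bool).toMeasure).map
    (rangeFactorization (cantorPoint D))

instance : IsProbabilityMeasure (cantorMeasure D) :=
  Measure.isProbabilityMeasure_map
    ((continuous_cantorPoint D).subtype_mk _).measurable.aemeasurable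

/-! ### Wormholes and the quotient -/

/-- The locations `w(m_1, …, m_l) = ∑ i ≤ l, m_i ∏ h ≤ i, j_h⁻¹` of the wormholes of level `l ≥ 1`,
where `0 ≤ m_i < j_i` for `i < l` and `0 < m_l < j_l`. -/
def wormholes (l : ℕ) : Set ℝ :=
  {x | ∃ m : ℕ → ℕ, (∀ i, 1 ≤ i → i < l → m i < D.js i) ∧ 0 < m l ∧ m l < D.js l ∧
    x = ∑ i ∈ Finset.Icc 1 l, (m i : ℝ) * ∏ h ∈ Finset.Icc 1 i, (D.js h : ℝ)⁻¹}

/-- One elementary identification: over a wormhole of level `l`, a point of `K_{a0}` with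
`|a| = l - 1` is glued to its translate in `K_{a1}`. -/
def Glued (p q : unitInterval × cantor D) : Prop :=
  ∃ (l : ℕ) (a : List Bool), 1 ≤ l ∧ a.length = l - 1 ∧
    p.1 = q.1 ∧ (p.1 : ℝ) ∈ wormholes D l ∧
    (p.2 : ℝ) ∈ cell D (a ++ [false]) ∧ (q.2 : ℝ) ∈ cell D (a ++ [true]) ∧
    (q.2 : ℝ) = p.2 + D.t ^ (l - 1) * (1 - D.t)

/-- The Laakso space: `[0, 1] × K` modulo the equivalence relation generated by the
identifications, with the quotient topology. -/
def Space : Type := Quotient (Relation.EqvGen.setoid (Glued D))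

instance : TopologicalSpace (Space D) :=
  inferInstanceAs (TopologicalSpace (Quotient (Relation.EqvGen.setoid (Glued D))))

instance : CompactSpace (Space D) :=
  inferInstanceAs (CompactSpace (Quotient (Relation.EqvGen.setoid (Glued D))))

instance : MeasurableSpace (Space D) := borel (Space D)

instance : BorelSpace (Space D) := ⟨rfl⟩

/-- The identification map `ι : [0, 1] × K → L`. -/
def proj (p : unitInterval × cantor D) : Space D :=
  Quotient.mk (Relation.EqvGen.setoid (Glued D)) p

lemma continuous_proj : Continuous (proj D) := continuous_quotient_mk'

/-- The `[0, 1]`-coordinate of a point of the Laakso space. -/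
def coord : Space D → ℝ :=
  Quotient.lift (fun p : unitInterval × cantor D => (p.1 : ℝ)) (by
    intro p q h
    have key : ∀ p q, Relation.EqvGen (Glued D) p q → (p.1 : ℝ) = q.1 := by
      intro p q h
      induction h with
      | rel p q h => exact congrArg Subtype.val h.choose_spec.choose_spec.2.2.1
      | refl => rfl
      | symm _ _ _ ih => exact ih.symm
      | trans _ _ _ _ _ ih₁ ih₂ => exact ih₁.trans ih₂
    exact key p q h)

/-- The measure `μ` on the Laakso space: the image under `ι` of Lebesgue times Bernoulli. -/
def mu : Measure (Space D) :=
  ((volume : Measure unitInterval).prod (cantorMeasure D)).map (proj D)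

instance : IsProbabilityMeasure (mu D) :=
  Measure.isProbabilityMeasure_map (continuous_proj D).measurable.aemeasurable

/-- The real Hilbert space `L²(L, μ)`. -/
abbrev L2 : Type := Lp ℝ 2 (mu D)

/-! ### Upper gradients and the Sobolev space -/

/-- A rectifiable curve in the Laakso space, parametrized by arc length on `[0, ℓ]`. The length of
a curve in the Laakso space, which defines its geodesic metric, is the distance it travels in the
`[0, 1]`-direction (passing through a wormhole costs no length), that is the variation of its
`[0, 1]`-coordinate. -/
def IsArcLengthCurve (l : ℝ) (γ : ℝ → Space D) : Prop :=
  0 ≤ l ∧ ContinuousOn γ (Icc 0 l) ∧ HasUnitSpeedOn (coord D ∘ γ) (Icc 0 l)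

/-- The Borel function `g ≥ 0` is an upper gradient of `f`: the inequality
`|f x - f y| ≤ ∫_γ g dm` holds for all `x`, `y` and all rectifiable curves `γ` from `x` to `y`. -/
def IsUpperGradient (f : Space D → ℝ) (g : Space D → ℝ≥0∞) : Prop :=
  Measurable g ∧ ∀ (l : ℝ) (γ : ℝ → Space D), IsArcLengthCurve D l γ →
    ENNReal.ofReal |f (γ 0) - f (γ l)| ≤ ∫⁻ s in Icc 0 l, g (γ s)

/-- Generalized upper gradients in `L²`, in the sense of Cheeger: `p` is the `L²`-limit of upper
gradients of functions that converge to `u` in `L²`. -/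
def IsGenUpperGradient (u p : L2 D) : Prop :=
  ∃ (f : ℕ → Space D → ℝ) (g : ℕ → Space D → ℝ≥0∞),
    (∀ n, MemLp (f n) 2 (mu D) ∧ ∫⁻ x, g n x ^ 2 ∂(mu D) < ∞ ∧ IsUpperGradient D (f n) (g n)) ∧
    Tendsto (fun n => eLpNorm (fun x => f n x - u x) 2 (mu D)) atTop (𝓝 0) ∧
    Tendsto (fun n => eLpNorm (fun x => (g n x).toReal - p x) 2 (mu D)) atTop (𝓝 0)

/-- `p` is the minimal generalized upper gradient `p_u` of `u`. -/
def IsMinGenUpperGradient (u p : L2 D) : Prop :=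
  IsGenUpperGradient D u p ∧ ∀ q : L2 D, IsGenUpperGradient D u q → p ≤ᵐ[mu D] q

/-- The Sobolev space `H^{1,2}`. -/
def sobolev : Set (L2 D) := {u | ∃ p, IsMinGenUpperGradient D u p}

/-! ### The smooth class and its closure -/

/-- The function `f̂(·, w)`, where `f̂ = f ∘ ι`, as a function on `ℝ` that is constant to the left
of `0` and to the right of `1`. -/
def hat (f : C(Space D, ℝ)) (w : cantor D) (x : ℝ) : ℝ :=
  f (proj D (projIcc 0 1 zero_le_one x, w))

/-- The endpoints of `[0, 1]` and the locations of the wormholes of level at most `n`. -/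
def nodes (n : ℕ) : Set ℝ := {0, 1} ∪ ⋃ l ∈ Icc 1 n, wormholes D l

/-- The class `𝒢_n`: continuous `f` on the Laakso space such that `f̂(x, ·)` is constant on the
cells of level `n` and `f̂(·, w)` is continuously differentiable between neighbouring nodes of
level at most `n`, the derivative having finite limits at the nodes. -/
def smoothClassAt (n : ℕ) : Set C(Space D, ℝ) :=
  {f | (∀ a : List Bool, a.length = n → ∀ w w' : cantor D,
          (w : ℝ) ∈ cell D a → (w' : ℝ) ∈ cell D a → ∀ x : unitInterval,
            f (proj D (x, w)) = f (proj D (x, w'))) ∧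
       ∀ w : cantor D, ∀ a ∈ nodes D n, ∀ b ∈ nodes D n, a < b → Disjoint (Ioo a b) (nodes D n) →
          ContDiffOn ℝ 1 (hat D f w) (Ioo a b) ∧
          (∃ c : ℝ, Tendsto (deriv (hat D f w)) (𝓝[>] a) (𝓝 c)) ∧
          (∃ c : ℝ, Tendsto (deriv (hat D f w)) (𝓝[<] b) (𝓝 c))}

/-- The smooth class `𝒢 = ⋃ n, 𝒢_n`. -/
def smoothClass : Set C(Space D, ℝ) := ⋃ n, smoothClassAt D n

/-- The class in `L²(L, μ)` of a continuous function. -/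
def toL2 (f : C(Space D, ℝ)) : L2 D := ContinuousMap.toLp 2 (mu D) ℝ f

/-- Convergence `f n → u` in the graph norm `‖v‖ = ‖v‖₂ + ‖p_v‖₂` of `H^{1,2}`. -/
def TendstoSobolev (f : ℕ → C(Space D, ℝ)) (u : L2 D) : Prop :=
  ∃ p : ℕ → L2 D, (∀ n, IsMinGenUpperGradient D (u - toL2 D (f n)) (p n)) ∧
    Tendsto (fun n => ‖u - toL2 D (f n)‖ + ‖p n‖) atTop (𝓝 0)

/-- The closure of `𝒢` in `H^{1,2}`. -/
def domain : Set (L2 D) :=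
  {u | u ∈ sobolev D ∧ ∃ f : ℕ → C(Space D, ℝ), (∀ n, f n ∈ smoothClass D) ∧ TendstoSobolev D f u}

/-- `v` is the derivative `∂f/∂x` of `f ∈ 𝒢`, given by `v ∘ ι = ∂f̂/∂x` almost everywhere. -/
def IsSmoothXDeriv (f : C(Space D, ℝ)) (v : L2 D) : Prop :=
  ∀ᵐ p ∂((volume : Measure unitInterval).prod (cantorMeasure D)),
    v (proj D p) = deriv (hat D f p.2) (p.1 : ℝ)

/-- `v` is the derivative `∂u/∂x` of `u` in the closure of `𝒢`: the `L²`-limit of the derivatives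
of a sequence in `𝒢` that converges to `u` in `H^{1,2}`. -/
def IsXDeriv (u v : L2 D) : Prop :=
  ∃ (f : ℕ → C(Space D, ℝ)) (d : ℕ → L2 D), (∀ n, f n ∈ smoothClass D) ∧ TendstoSobolev D f u ∧
    (∀ n, IsSmoothXDeriv D (f n) (d n)) ∧ Tendsto d atTop (𝓝 v)

open Classical in
/-- The derivative `∂u/∂x` (and `0` for `u` without derivative). -/
def xDeriv (u : L2 D) : L2 D := if h : ∃ v, IsXDeriv D u v then h.choose else 0

/-- The bilinear form `ℰ(u, v) = ∫ (∂u/∂x) (∂v/∂x) dμ`, to be used for `u`, `v` in the closure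
of `𝒢`. -/
def form (u v : L2 D) : ℝ := ∫ x, xDeriv D u x * xDeriv D v x ∂(mu D)

end LaaksoSpace

/-- A Dirichlet form on the real Hilbert space `L²(X, μ)`: a densely defined, nonnegative,
symmetric bilinear form that is closed (its domain is complete for the norm
`(ℰ(u, u) + ‖u‖²) ^ (1/2)`) and on which the unit contraction `u ↦ (u ∨ 0) ∧ 1` operates.
Only the values of `E` on `dom` matter. -/
structure IsDirichletForm {X : Type*} [MeasurableSpace X] (μ : Measure X)
    (dom : Set (Lp ℝ 2 μ)) (E : Lp ℝ 2 μ → Lp ℝ 2 μ → ℝ) : Prop where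
  zero_mem : (0 : Lp ℝ 2 μ) ∈ dom
  add_mem : ∀ u ∈ dom, ∀ v ∈ dom, u + v ∈ dom
  smul_mem : ∀ (c : ℝ), ∀ u ∈ dom, c • u ∈ dom
  dense : Dense dom
  add_left : ∀ u ∈ dom, ∀ v ∈ dom, ∀ w ∈ dom, E (u + v) w = E u w + E v w
  smul_left : ∀ (c : ℝ), ∀ u ∈ dom, ∀ v ∈ dom, E (c • u) v = c * E u v
  symm : ∀ u ∈ dom, ∀ v ∈ dom, E u v = E v u
  nonneg : ∀ u ∈ dom, 0 ≤ E u u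
  closed : ∀ u : ℕ → Lp ℝ 2 μ, (∀ n, u n ∈ dom) →
    (∀ ε > 0, ∃ N, ∀ m ≥ N, ∀ n ≥ N, E (u m - u n) (u m - u n) + ‖u m - u n‖ ^ 2 < ε) →
    ∃ v ∈ dom, Tendsto (fun n => E (u n - v) (u n - v) + ‖u n - v‖ ^ 2) atTop (𝓝 0)
  markov : ∀ u ∈ dom, ∃ v ∈ dom, (v =ᵐ[μ] fun x => min (max (u x) 0) 1) ∧ E v v ≤ E u u

end

noncomputable section

namespace LaaksoSpace

variable (D : Data)

/-! ### Addresses of points of the Cantor set -/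

/-! Everything is read off from the closure in L² × L² of the graph of ∂/∂x on 𝒢 (`closedGraph`).
The central fact, `isMinGenUpperGradient_abs`, is that a pair (u, v) in this closure satisfies p_u =
|v|.

That |v| is a generalized upper gradient comes from `isUpperGradient_gradFun`. A function f of 𝒢_n
is locally controlled by the [0, 1]-coordinate, even at wormholes, because it takes finitely many
values on each fibre. So f ∘ γ is Lipschitz along an arc length curve, and integrating its
derivative gives the upper gradient inequality for |∂f/∂x|, modified over finitely many coordinates.

That |v| lies below every generalized upper gradient q is `abs_le_of_isGenUpperGradient`. Take
smooth f_n → u with derivatives tending to v, and h_n → u with upper gradients g_n → q. Along a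
subsequence all errors tend to zero on almost every segment [0, 1] × {w}. Testing the upper gradient
inequality on such segments gives |∫ v| ≤ ∫ |q| over almost all intervals, and Lebesgue
differentiation gives |v| ≤ q, as q is a limit of nonnegative functions.

It follows that the derivative is closable (p_0 = 0 forces v = 0), that the graph norm on the
closure of 𝒢 is ‖u‖ + ‖∂u/∂x‖, and hence that the domain is the projection of `closedGraph`
(`isXDeriv_iff`, `mem_domain_iff`). Completeness of the form is then closedness of this graph. For
the Markov property, the chain rule `comp_mem_closedGraph` is applied to smooth 1-Lipschitz
approximations of the unit contraction, and the limit stays in the closed graph. For density, a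
function orthogonal to 𝒢 is tested against products φ(x) 1_A(w), with A a cell and φ vanishing near
the nodes; these descend to L and force the function to vanish. -/

lemma t_lt_half : D.t < 1 / 2 := by
  have h0 := D.t_pos
  have h1 : 0 < Real.log (1 / D.t) := Real.log_pos (by rw [lt_div_iff₀ h0]; linarith [D.t_lt_one])
  have h2 := D.dim_eq
  rw [div_eq_iff h1.ne'] at h2
  -- Q < 2 enters here: log 2 = (Q - 1) log(1/t) with Q - 1 < 1.
  have h3 : Real.log 2 < Real.log (1 / D.t) := by nlinarith [D.Q_lt_two]
  have h4 := (Real.log_lt_log_iff (by norm_num) (by positivity)).1 h3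
  rw [lt_div_iff₀ h0] at h4
  linarith

lemma summable_cantorTerm (s : ℕ → Bool) :
    Summable fun i => if s i then D.t ^ i * (1 - D.t) else 0 := by
  have ht := D.t_pos
  have ht1 := D.t_lt_one
  refine Summable.of_nonneg_of_le (fun i => ?_) (fun i => ?_)
    ((summable_geometric_of_lt_one ht.le ht1).mul_right (1 - D.t))
  · split_ifs
    · exact mul_nonneg (pow_nonneg ht.le i) (by linarith)
    · exact le_rfl
  · split_ifs
    · exact le_rfl
    · exact mul_nonneg (pow_nonneg ht.le i) (by linarith)

lemma cantorPoint_mem_Icc (s : ℕ → Bool) : cantorPoint D s ∈ Icc (0 : ℝ) 1 := by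
  have ht := D.t_pos
  have ht1 := D.t_lt_one
  have h : ∀ i, 0 ≤ D.t ^ i * (1 - D.t) := fun i =>
    mul_nonneg (pow_nonneg ht.le i) (by linarith)
  constructor
  · exact tsum_nonneg fun i => by split_ifs <;> simp [h]
  · have h1 : ∑' i, D.t ^ i * (1 - D.t) = 1 := by
      rw [tsum_mul_right, tsum_geometric_of_lt_one ht.le ht1]
      exact inv_mul_cancel₀ (by linarith)
    rw [← h1]
    refine (summable_cantorTerm D s).tsum_le_tsum (fun i => ?_)
      ((summable_geometric_of_lt_one ht.le ht1).mul_right _)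
    split_ifs <;> simp [h]

lemma cantorPoint_eq_contraction (s : ℕ → Bool) :
    cantorPoint D s = contraction D (s 0) (cantorPoint D fun i => s (i + 1)) := by
  have h : ∀ i, (if s (i + 1) then D.t ^ (i + 1) * (1 - D.t) else 0) =
      D.t * (if s (i + 1) then D.t ^ i * (1 - D.t) else 0) := by
    intro i
    split_ifs <;> ring
  unfold cantorPoint contraction
  rw [(summable_cantorTerm D s).tsum_eq_zero_add]
  simp_rw [h]
  rw [tsum_mul_left]
  cases s 0 <;> simp [add_comm]

/-- Since t < 1/2, the images [0, t] and [1 - t, 1] of the unit interval are disjoint, so the digit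
can be recovered from the image point. -/
lemma contraction_inj {b c : Bool} {x y : ℝ} (hx : x ∈ Icc (0 : ℝ) 1) (hy : y ∈ Icc (0 : ℝ) 1)
    (h : contraction D b x = contraction D c y) : b = c ∧ x = y := by
  have ht := D.t_pos
  have ht1 := t_lt_half D
  obtain ⟨hx0, hx1⟩ := hx
  obtain ⟨hy0, hy1⟩ := hy
  have hxt : D.t * x ≤ D.t := by nlinarith
  have hyt : D.t * y ≤ D.t := by nlinarith
  have hx' : 0 ≤ D.t * x := by positivity
  have hy' : 0 ≤ D.t * y := by positivity
  have hxy : D.t * x = D.t * y → x = y := fun h => mul_left_cancel₀ ht.ne' h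
  cases b <;> cases c <;> simp only [contraction, if_true, Bool.false_eq_true, if_false] at h
  · exact ⟨rfl, hxy h⟩
  · linarith
  · linarith
  · exact ⟨rfl, hxy (by linarith)⟩

lemma cantorPoint_injective : Function.Injective (cantorPoint D) := by
  intro s s' h
  funext n
  induction n generalizing s s' with
  | zero =>
    rw [cantorPoint_eq_contraction, cantorPoint_eq_contraction D s'] at h
    exact (contraction_inj D (cantorPoint_mem_Icc D _) (cantorPoint_mem_Icc D _) h).1
  | succ n ih =>
    rw [cantorPoint_eq_contraction, cantorPoint_eq_contraction D s'] at h
    exact ih (contraction_inj D (cantorPoint_mem_Icc D _) (cantorPoint_mem_Icc D _) h).2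

/-- The homeomorphism between `0`-`1` sequences and the Cantor set. -/
def coding : (ℕ → Bool) ≃ₜ cantor D :=
  Continuous.homeoOfEquivCompactToT2
    (f := Equiv.ofInjective (cantorPoint D) (cantorPoint_injective D))
    ((continuous_cantorPoint D).subtype_mk _)

/-- The infinite address of a point of the Cantor set. -/
def digits (w : cantor D) : ℕ → Bool := (coding D).symm w

lemma continuous_digits : Continuous (digits D) := (coding D).symm.continuous

lemma cantorPoint_digits (w : cantor D) : cantorPoint D (digits D w) = w :=
  congrArg Subtype.val ((coding D).apply_symm_apply w)

lemma cantorPoint_mem_cell (a : List Bool) (s : ℕ → Bool) :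
    cantorPoint D s ∈ cell D a ↔ ∀ i (h : i < a.length), s i = a[i] := by
  induction a generalizing s with
  | nil => simp [cell, cantor]
  | cons b a ih =>
    constructor
    · rintro ⟨y, hy, hys⟩
      -- Cells lie in K, so `y` has an address of its own to which the induction hypothesis can be
      -- applied.
      have hyc : y ∈ range (cantorPoint D) := by
        clear ih hys
        induction a generalizing y with
        | nil => exact hy
        | cons c a ih' =>
          obtain ⟨z, hz, rfl⟩ := hy
          obtain ⟨s', rfl⟩ := ih' z hz
          refine ⟨fun i => Nat.casesOn i c s', ?_⟩
          exact cantorPoint_eq_contraction D _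
      obtain ⟨s', rfl⟩ := hyc
      rw [cantorPoint_eq_contraction D s] at hys
      obtain ⟨h0, h1⟩ :=
        contraction_inj D (cantorPoint_mem_Icc D _) (cantorPoint_mem_Icc D _) hys
      rw [h1, ih] at hy
      intro i h
      cases i with
      | zero => exact h0.symm
      | succ i => exact hy i (by simpa using h)
    · intro h
      rw [cantorPoint_eq_contraction]
      have h0 : s 0 = b := h 0 (by simp)
      rw [h0]
      refine mem_image_of_mem _ ((ih _).2 fun i hi => ?_)
      exact h (i + 1) (by simpa using hi)

lemma mem_cell_iff (a : List Bool) (w : cantor D) :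
    (w : ℝ) ∈ cell D a ↔ ∀ i (h : i < a.length), digits D w i = a[i] := by
  rw [← cantorPoint_mem_cell, cantorPoint_digits]

/-- The points `w` and `w'` of the Cantor set lie in the same cell of level `n`. -/
def SameCell (n : ℕ) (w w' : cantor D) : Prop := ∀ i < n, digits D w i = digits D w' i

variable {D}

lemma SameCell.symm {n : ℕ} {w w' : cantor D} (h : SameCell D n w w') : SameCell D n w' w :=
  fun i hi => (h i hi).symm

lemma SameCell.trans {n : ℕ} {w w' w'' : cantor D} (h : SameCell D n w w')
    (h' : SameCell D n w' w'') : SameCell D n w w'' :=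
  fun i hi => (h i hi).trans (h' i hi)

lemma SameCell.mono {m n : ℕ} (hmn : m ≤ n) {w w' : cantor D} (h : SameCell D n w w') :
    SameCell D m w w' :=
  fun i hi => h i (hi.trans_le hmn)

lemma sameCell_of_mem_cell {a : List Bool} {w w' : cantor D} (hw : (w : ℝ) ∈ cell D a)
    (hw' : (w' : ℝ) ∈ cell D a) : SameCell D a.length w w' := fun i hi => by
  rw [(mem_cell_iff D a w).1 hw i hi, (mem_cell_iff D a w').1 hw' i hi]

lemma SameCell.exists_cell {n : ℕ} {w w' : cantor D} (h : SameCell D n w w') :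
    ∃ a : List Bool, a.length = n ∧ (w : ℝ) ∈ cell D a ∧ (w' : ℝ) ∈ cell D a :=
  ⟨List.ofFn fun i : Fin n => digits D w i, by simp, (mem_cell_iff D _ w).2 (by simp),
    (mem_cell_iff D _ w').2 fun i hi => by
      simpa using (h i (by simpa using hi)).symm⟩

variable (D)

lemma isOpen_sameCell (n : ℕ) (w : cantor D) : IsOpen {w' | SameCell D n w' w} := by
  have : {w' | SameCell D n w' w} = ⋂ i ∈ Iio n, {w' | digits D w' i = digits D w i} := by
    ext w'; simp [SameCell]
  rw [this]
  refine (finite_Iio n).isOpen_biInter fun i _ => ?_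
  exact (isOpen_discrete {digits D w i}).preimage
    ((continuous_apply i).comp (continuous_digits D))

lemma isClosed_sameCell (n : ℕ) (w : cantor D) : IsClosed {w' | SameCell D n w' w} := by
  have : {w' | SameCell D n w' w} = ⋂ i ∈ Iio n, {w' | digits D w' i = digits D w i} := by
    ext w'; simp [SameCell]
  rw [this]
  refine isClosed_biInter fun i _ => ?_
  exact (isClosed_discrete {digits D w i}).preimage
    ((continuous_apply i).comp (continuous_digits D))

/-- Finitely many points meet all cells of level `n`. -/
lemma exists_finite_sameCell (n : ℕ) :
    ∃ S : Set (cantor D), S.Finite ∧ ∀ w, ∃ w' ∈ S, SameCell D n w w' := by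
  obtain ⟨S, hS⟩ := isCompact_univ.elim_finite_subcover
    (fun w : cantor D => {w' | SameCell D n w' w}) (isOpen_sameCell D n)
    (fun w _ => mem_iUnion.2 ⟨w, fun _ _ => rfl⟩)
  refine ⟨S, S.finite_toSet, fun w => ?_⟩
  simpa using hS (mem_univ w)

/-! ### Wormholes and nodes -/

/-- This is a mixed-radix expansion. The bound is sharper than 1 so that the induction closes: the
unit left over at stage l has room for `js (l + 1)` units of the next stage, one of which is again
left over. -/
lemma sum_wormhole_mem_Icc (l : ℕ) (m : ℕ → ℕ) (hm : ∀ i ∈ Finset.Icc 1 l, m i < D.js i) :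
    (∑ i ∈ Finset.Icc 1 l, (m i : ℝ) * ∏ h ∈ Finset.Icc 1 i, (D.js h : ℝ)⁻¹) ∈
      Icc (0 : ℝ) (1 - ∏ h ∈ Finset.Icc 1 l, (D.js h : ℝ)⁻¹) := by
  refine ⟨Finset.sum_nonneg fun i _ => by positivity, ?_⟩
  induction l with
  | zero => simp
  | succ l ih =>
    have h1 := ih fun i hi => hm i (Finset.Icc_subset_Icc_right (Nat.le_succ l) hi)
    rw [Finset.sum_Icc_succ_top (by omega), Finset.prod_Icc_succ_top (by omega)]
    have h2 := hm (l + 1) (by simp)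
    have h3 : (m (l + 1) : ℝ) + 1 ≤ D.js (l + 1) := by exact_mod_cast h2
    have h4 : (0 : ℝ) < D.js (l + 1) := lt_of_lt_of_le (by positivity) h3
    have h5 : 0 ≤ ∏ h ∈ Finset.Icc 1 l, (D.js h : ℝ)⁻¹ :=
      Finset.prod_nonneg fun i _ => by positivity
    have h6 : ((m (l + 1) : ℝ) + 1) * (D.js (l + 1) : ℝ)⁻¹ ≤ 1 := by
      rwa [← div_eq_mul_inv, div_le_one h4]
    nlinarith [mul_le_mul_of_nonneg_left h6 h5]

lemma finite_sum_wormhole (l : ℕ) : {x : ℝ | ∃ m : ℕ → ℕ, (∀ i ∈ Finset.Icc 1 l, m i < D.js i) ∧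
    x = ∑ i ∈ Finset.Icc 1 l, (m i : ℝ) * ∏ h ∈ Finset.Icc 1 i, (D.js h : ℝ)⁻¹}.Finite := by
  induction l with
  | zero => exact (finite_singleton (0 : ℝ)).subset (by rintro x ⟨m, -, rfl⟩; simp)
  | succ l ih =>
    refine (ih.image2 (fun x (k : ℕ) => x + (k : ℝ) * ∏ h ∈ Finset.Icc 1 (l + 1), (D.js h : ℝ)⁻¹)
      (finite_Iio (D.js (l + 1)))).subset ?_
    rintro x ⟨m, hm, rfl⟩
    rw [Finset.sum_Icc_succ_top (by omega)]
    exact ⟨_, ⟨m, fun i hi => hm i (Finset.Icc_subset_Icc_right (Nat.le_succ l) hi), rfl⟩,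
      m (l + 1), hm (l + 1) (by simp), rfl⟩

variable {D} in
lemma wormholes_index {l : ℕ} {m : ℕ → ℕ} (h : ∀ i, 1 ≤ i → i < l → m i < D.js i)
    (hl : m l < D.js l) : ∀ i ∈ Finset.Icc 1 l, m i < D.js i := fun i hi => by
  obtain ⟨h1, h2⟩ := Finset.mem_Icc.1 hi
  rcases h2.lt_or_eq with h3 | rfl
  exacts [h i h1 h3, hl]

lemma finite_wormholes (l : ℕ) : (wormholes D l).Finite :=
  (finite_sum_wormhole D l).subset fun _ ⟨m, h1, _, h3, h4⟩ => ⟨m, wormholes_index h1 h3, h4⟩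

lemma wormholes_subset_Icc (l : ℕ) : wormholes D l ⊆ Icc 0 1 := by
  rintro x ⟨m, h1, -, h3, rfl⟩
  refine Icc_subset_Icc_right ?_ (sum_wormhole_mem_Icc D l m (wormholes_index h1 h3))
  have : 0 ≤ ∏ h ∈ Finset.Icc 1 l, (D.js h : ℝ)⁻¹ := Finset.prod_nonneg fun i _ => by positivity
  linarith

lemma finite_nodes (n : ℕ) : (nodes D n).Finite :=
  (toFinite {(0 : ℝ), 1}).union ((finite_Icc 1 n).biUnion fun l _ => finite_wormholes D l)

lemma nodes_subset_Icc (n : ℕ) : nodes D n ⊆ Icc 0 1 := by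
  refine union_subset ?_ (iUnion₂_subset fun l _ => wormholes_subset_Icc D l)
  rintro x (rfl | rfl) <;> simp

lemma zero_mem_nodes (n : ℕ) : (0 : ℝ) ∈ nodes D n := Or.inl (Or.inl rfl)

lemma one_mem_nodes (n : ℕ) : (1 : ℝ) ∈ nodes D n := Or.inl (Or.inr rfl)

lemma nodes_mono {m n : ℕ} (h : m ≤ n) : nodes D m ⊆ nodes D n :=
  union_subset_union_right _ (biUnion_subset_biUnion_left (Icc_subset_Icc_right h))

/-- Every interval without nodes lies between two neighbouring nodes. -/
lemma exists_gap_superset (n : ℕ) {a b : ℝ} (ha : 0 ≤ a) (hab : a < b) (hb : b ≤ 1)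
    (h : Disjoint (Ioo a b) (nodes D n)) :
    ∃ a' ∈ nodes D n, ∃ b' ∈ nodes D n, a' ≤ a ∧ b ≤ b' ∧ a' < b' ∧
      Disjoint (Ioo a' b') (nodes D n) := by
  obtain ⟨a', ⟨ha', haa⟩, hmax⟩ := ((finite_nodes D n).inter_of_left (Iic a)).exists_maximal
    ⟨0, zero_mem_nodes D n, ha⟩
  obtain ⟨b', ⟨hb', hbb⟩, hmin⟩ := ((finite_nodes D n).inter_of_left (Ici b)).exists_minimal
    ⟨1, one_mem_nodes D n, hb⟩
  simp only [mem_Iic, mem_Ici] at haa hbb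
  refine ⟨a', ha', b', hb', haa, hbb, haa.trans_lt (hab.trans_le hbb), ?_⟩
  rw [Set.disjoint_left] at h ⊢
  intro x hx hxn
  by_cases h1 : x ≤ a
  · exact absurd (hmax ⟨hxn, h1⟩ hx.1.le) (not_le.2 hx.1)
  · by_cases h2 : b ≤ x
    · exact absurd (hmin ⟨hxn, h2⟩ hx.2.le) (not_le.2 hx.2)
    · exact h ⟨not_le.1 h1, not_le.1 h2⟩ hxn

/-- A small interval around the point avoids the closed set of nodes and stays inside [0, 1]; it is
then enlarged to a full gap. -/
lemma exists_gap (n : ℕ) {x : ℝ} (hx : x ∈ Icc (0 : ℝ) 1) (hxn : x ∉ nodes D n) :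
    ∃ a ∈ nodes D n, ∃ b ∈ nodes D n, a < b ∧ x ∈ Ioo a b ∧ Disjoint (Ioo a b) (nodes D n) := by
  have h0 : x ≠ 0 := fun h => hxn (h ▸ zero_mem_nodes D n)
  have h1 : x ≠ 1 := fun h => hxn (h ▸ one_mem_nodes D n)
  have hx0 : 0 < x := lt_of_le_of_ne hx.1 (Ne.symm h0)
  have hx1 : x < 1 := lt_of_le_of_ne hx.2 h1
  obtain ⟨e, he, hball⟩ := Metric.isOpen_iff.1 (finite_nodes D n).isClosed.isOpen_compl x hxn
  set δ := min e (min x (1 - x))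
  have hδ : 0 < δ := lt_min he (lt_min hx0 (by linarith))
  have hδ1 : δ ≤ e := min_le_left _ _
  have hδ2 : δ ≤ x := (min_le_right _ _).trans (min_le_left _ _)
  have hδ3 : δ ≤ 1 - x := (min_le_right _ _).trans (min_le_right _ _)
  obtain ⟨a, ha, b, hb, h1, h2, h3, h4⟩ := exists_gap_superset D n
    (a := x - δ) (b := x + δ) (by linarith) (by linarith) (by linarith) (by
      rw [Set.disjoint_left]
      intro y hy
      apply hball
      rw [Metric.mem_ball, Real.dist_eq, abs_lt]
      constructor <;> linarith [hy.1, hy.2])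
  exact ⟨a, ha, b, hb, h3, ⟨by linarith, by linarith⟩, h4⟩

variable {D} in
/-- Off the nodes of level `n` the identifications respect the cells of level `n`. -/
lemma Glued.sameCell {n : ℕ} {p q : unitInterval × cantor D} (h : Glued D p q)
    (hp : (p.1 : ℝ) ∉ nodes D n) : SameCell D n p.2 q.2 := by
  obtain ⟨l, a, hl, ha, -, hw, h1, h2, -⟩ := h
  have hn : n < l := by
    by_contra hn
    exact hp (Or.inr (mem_biUnion (show l ∈ Icc 1 n from ⟨hl, not_lt.1 hn⟩) hw))
  intro i hi
  -- The common prefix `a` has length l - 1 ≥ n, so it contains the first n digits of both points.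
  have h3 : i < a.length := by omega
  rw [(mem_cell_iff D _ _).1 h1 i (by simp; omega), (mem_cell_iff D _ _).1 h2 i (by simp; omega),
    List.getElem_append_left h3, List.getElem_append_left h3]

/-! ### Descent of functions and sets to the quotient -/

lemma fst_eq_of_glued {p q : unitInterval × cantor D} (h : Glued D p q) : p.1 = q.1 :=
  h.choose_spec.choose_spec.2.2.1

/-- A function on `[0, 1] × K` that respects the elementary identifications descends to `L`. -/
def lift {α : Type*} (F : unitInterval × cantor D → α) (hF : ∀ p q, Glued D p q → F p = F q) :
    Space D → α :=
  Quotient.lift F fun p q (h : Relation.EqvGen (Glued D) p q) => by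
    induction h with
    | rel p q h => exact hF p q h
    | refl => rfl
    | symm _ _ _ ih => exact ih.symm
    | trans _ _ _ _ _ ih ih' => exact ih.trans ih'

lemma isQuotientMap_proj : IsQuotientMap (proj D) := isQuotientMap_quotient_mk'

lemma surjective_proj : Function.Surjective (proj D) := (isQuotientMap_proj D).surjective

lemma coord_proj (p : unitInterval × cantor D) : coord D (proj D p) = p.1 := rfl

lemma continuous_coord : Continuous (coord D) :=
  (isQuotientMap_proj D).continuous_iff.2 (continuous_subtype_val.comp continuous_fst)

/-- The points over the gaps of level `n` and the cell of level `n` of `w`. -/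
def column (n : ℕ) (w : cantor D) : Set (Space D) :=
  {q | lift D (fun p => (p.1 : ℝ) ∉ nodes D n ∧ SameCell D n p.2 w) (fun p q h => by
    rw [← fst_eq_of_glued D h]
    refine propext (and_congr_right fun hp => ?_)
    have := h.sameCell hp
    exact ⟨this.symm.trans, this.trans⟩) q}

lemma proj_mem_column {n : ℕ} {w : cantor D} {p : unitInterval × cantor D} :
    proj D p ∈ column D n w ↔ (p.1 : ℝ) ∉ nodes D n ∧ SameCell D n p.2 w := Iff.rfl

/-- Columns serve as neighbourhoods in L of points off the nodes: on them a function of 𝒢_n depends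
on the [0, 1]-coordinate alone. -/
lemma isOpen_column (n : ℕ) (w : cantor D) : IsOpen (column D n w) := by
  refine (isQuotientMap_proj D).isOpen_preimage.1 ?_
  have : proj D ⁻¹' column D n w =
      ((fun x : unitInterval => (x : ℝ)) ⁻¹' (nodes D n)ᶜ) ×ˢ {w' | SameCell D n w' w} := by
    ext p; exact proj_mem_column D
  rw [this]
  exact ((finite_nodes D n).isClosed.isOpen_compl.preimage continuous_subtype_val).prod
    (isOpen_sameCell D n w)

/-! ### Continuously differentiable pieces -/

/-- `φ` is continuously differentiable on `(a, b)`, the derivative having finite limits at `a`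
and `b`. -/
def IsPiece (φ : ℝ → ℝ) (a b : ℝ) : Prop :=
  ContDiffOn ℝ 1 φ (Ioo a b) ∧ (∃ c : ℝ, Tendsto (deriv φ) (𝓝[>] a) (𝓝 c)) ∧
    (∃ c : ℝ, Tendsto (deriv φ) (𝓝[<] b) (𝓝 c))

namespace IsPiece

variable {φ χ : ℝ → ℝ} {a b : ℝ}

lemma differentiableAt (h : IsPiece φ a b) {x : ℝ} (hx : x ∈ Ioo a b) : DifferentiableAt ℝ φ x :=
  (h.1.differentiableOn one_ne_zero).differentiableAt (isOpen_Ioo.mem_nhds hx)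

lemma continuousOn_deriv (h : IsPiece φ a b) : ContinuousOn (deriv φ) (Ioo a b) :=
  h.1.continuousOn_deriv_of_isOpen isOpen_Ioo le_rfl

lemma continuousAt_deriv (h : IsPiece φ a b) {x : ℝ} (hx : x ∈ Ioo a b) :
    ContinuousAt (deriv φ) x :=
  h.continuousOn_deriv.continuousAt (isOpen_Ioo.mem_nhds hx)

lemma mono (h : IsPiece φ a b) {a' b' : ℝ} (ha : a ≤ a') (hab : a' < b') (hb : b' ≤ b) :
    IsPiece φ a' b' := by
  refine ⟨h.1.mono (Ioo_subset_Ioo ha hb), ?_, ?_⟩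
  · rcases ha.eq_or_lt with rfl | ha
    · exact h.2.1
    · exact ⟨_, (h.continuousAt_deriv ⟨ha, hab.trans_le hb⟩).tendsto.mono_left
        nhdsWithin_le_nhds⟩
  · rcases hb.eq_or_lt with rfl | hb
    · exact h.2.2
    · exact ⟨_, (h.continuousAt_deriv ⟨ha.trans_lt hab, hb⟩).tendsto.mono_left
        nhdsWithin_le_nhds⟩

/-- The one-sided limits only see the derivative inside the interval, so they can be computed from
any formula `g` valid there. -/
lemma of_deriv_eq (hab : a < b) (h : ContDiffOn ℝ 1 φ (Ioo a b)) {g : ℝ → ℝ}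
    (hg : ∀ x ∈ Ioo a b, deriv φ x = g x) (ha : ∃ c : ℝ, Tendsto g (𝓝[>] a) (𝓝 c))
    (hb : ∃ c : ℝ, Tendsto g (𝓝[<] b) (𝓝 c)) : IsPiece φ a b := by
  obtain ⟨c, hc⟩ := ha
  obtain ⟨d, hd⟩ := hb
  refine ⟨h, ⟨c, hc.congr' ?_⟩, ⟨d, hd.congr' ?_⟩⟩
  · filter_upwards [Ioo_mem_nhdsGT hab] with x hx using (hg x hx).symm
  · filter_upwards [Ioo_mem_nhdsLT hab] with x hx using (hg x hx).symm

lemma add (hab : a < b) (h : IsPiece φ a b) (h' : IsPiece χ a b) :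
    IsPiece (fun x => φ x + χ x) a b := by
  refine of_deriv_eq hab (h.1.add h'.1) (g := fun x => deriv φ x + deriv χ x)
    (fun x hx => deriv_add (h.differentiableAt hx) (h'.differentiableAt hx)) ?_ ?_
  · obtain ⟨c, hc⟩ := h.2.1
    obtain ⟨d, hd⟩ := h'.2.1
    exact ⟨_, hc.add hd⟩
  · obtain ⟨c, hc⟩ := h.2.2
    obtain ⟨d, hd⟩ := h'.2.2
    exact ⟨_, hc.add hd⟩

lemma comp (hab : a < b) (h : IsPiece φ a b) (hφ : Continuous φ) {ψ : ℝ → ℝ}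
    (hψ : ContDiff ℝ 1 ψ) : IsPiece (fun x => ψ (φ x)) a b := by
  have hd : Continuous (deriv ψ) := hψ.continuous_deriv le_rfl
  refine of_deriv_eq hab (hψ.comp_contDiffOn h.1) (g := fun x => deriv ψ (φ x) * deriv φ x)
    (fun x hx => ?_) ?_ ?_
  · exact deriv_comp x (hψ.differentiable one_ne_zero _) (h.differentiableAt hx)
  · obtain ⟨c, hc⟩ := h.2.1
    exact ⟨_, (((hd.comp hφ).tendsto a).mono_left nhdsWithin_le_nhds).mul hc⟩
  · obtain ⟨c, hc⟩ := h.2.2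
    exact ⟨_, (((hd.comp hφ).tendsto b).mono_left nhdsWithin_le_nhds).mul hc⟩

/-- The one-sided limits extend the derivative continuously to the compact interval [a, b]. -/
lemma exists_bound (h : IsPiece φ a b) :
    ∃ C, ∀ x ∈ Ioo a b, |deriv φ x| ≤ C := by
  obtain ⟨c, hc⟩ := h.2.1
  obtain ⟨d, hd⟩ := h.2.2
  have h1 := continuousOn_Icc_extendFrom_Ioo h.continuousOn_deriv hc hd
  obtain ⟨C, hC⟩ := isCompact_Icc.exists_bound_of_continuousOn h1
  refine ⟨C, fun x hx => ?_⟩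
  have h2 := hC x (Ioo_subset_Icc_self hx)
  rwa [extendFrom_eq (subset_closure hx)
    ((h.continuousAt_deriv hx).tendsto.mono_left nhdsWithin_le_nhds)] at h2

end IsPiece

/-! ### The smooth class -/

lemma continuous_hat (f : C(Space D, ℝ)) (w : cantor D) : Continuous (hat D f w) :=
  f.continuous.comp ((continuous_proj D).comp (continuous_projIcc.prodMk continuous_const))

lemma hat_coe (f : C(Space D, ℝ)) (w : cantor D) (x : unitInterval) :
    hat D f w x = f (proj D (x, w)) := by
  simp [hat, projIcc_val]

lemma hat_of_mem (f : C(Space D, ℝ)) (w : cantor D) {x : ℝ} (hx : x ∈ Icc (0 : ℝ) 1) :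
    hat D f w x = f (proj D (⟨x, hx⟩, w)) :=
  hat_coe D f w ⟨x, hx⟩

variable {D}

lemma mem_smoothClassAt_iff {n : ℕ} {f : C(Space D, ℝ)} : f ∈ smoothClassAt D n ↔
    (∀ w w' : cantor D, SameCell D n w w' → ∀ x : unitInterval,
      f (proj D (x, w)) = f (proj D (x, w'))) ∧
    ∀ w : cantor D, ∀ a ∈ nodes D n, ∀ b ∈ nodes D n, a < b → Disjoint (Ioo a b) (nodes D n) →
      IsPiece (hat D f w) a b := by
  refine and_congr_left fun _ => ⟨fun h w w' hw => ?_, fun h a ha w w' hw hw' => ?_⟩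
  · obtain ⟨a, ha, h1, h2⟩ := hw.exists_cell
    exact h a ha w w' h1 h2
  · exact h w w' (ha ▸ sameCell_of_mem_cell hw hw')

/-- Raising the level refines both the cells and the gaps: each gap of level n lies in a gap of
level m, and pieces restrict. -/
lemma smoothClassAt_mono {m n : ℕ} (hmn : m ≤ n) : smoothClassAt D m ⊆ smoothClassAt D n := by
  intro f hf
  rw [mem_smoothClassAt_iff] at hf ⊢
  refine ⟨fun w w' hw => hf.1 w w' (hw.mono hmn), fun w a ha b hb hab hd => ?_⟩
  obtain ⟨a', ha', b', hb', h1, h2, h3, h4⟩ := exists_gap_superset D m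
    (nodes_subset_Icc D n ha).1 hab (nodes_subset_Icc D n hb).2
    (hd.mono_right (nodes_mono D hmn))
  exact (hf.2 w a' ha' b' hb' h3 h4).mono h1 hab h2

lemma add_mem_smoothClassAt {n : ℕ} {f g : C(Space D, ℝ)} (hf : f ∈ smoothClassAt D n)
    (hg : g ∈ smoothClassAt D n) : f + g ∈ smoothClassAt D n := by
  rw [mem_smoothClassAt_iff] at *
  exact ⟨fun w w' hw x => congrArg₂ (· + ·) (hf.1 w w' hw x) (hg.1 w w' hw x),
    fun w a ha b hb hab hd => (hf.2 w a ha b hb hab hd).add hab (hg.2 w a ha b hb hab hd)⟩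

/-- Composition with a continuous function of one variable. -/
def postcomp {ψ : ℝ → ℝ} (hψ : Continuous ψ) (f : C(Space D, ℝ)) : C(Space D, ℝ) :=
  (ContinuousMap.mk ψ hψ).comp f

lemma postcomp_mem_smoothClassAt {n : ℕ} {f : C(Space D, ℝ)} (hf : f ∈ smoothClassAt D n)
    {ψ : ℝ → ℝ} (hψ : ContDiff ℝ 1 ψ) : postcomp hψ.continuous f ∈ smoothClassAt D n := by
  rw [mem_smoothClassAt_iff] at *
  exact ⟨fun w w' hw x => congrArg ψ (hf.1 w w' hw x),
    fun w a ha b hb hab hd => (hf.2 w a ha b hb hab hd).comp hab (continuous_hat D f w) hψ⟩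

lemma smul_mem_smoothClassAt {n : ℕ} (c : ℝ) {f : C(Space D, ℝ)} (hf : f ∈ smoothClassAt D n) :
    c • f ∈ smoothClassAt D n :=
  postcomp_mem_smoothClassAt hf (ψ := fun x => c * x) (contDiff_const.mul contDiff_id)

lemma hat_eq_of_sameCell {n : ℕ} {f : C(Space D, ℝ)} (hf : f ∈ smoothClassAt D n)
    {w w' : cantor D} (h : SameCell D n w w') : hat D f w = hat D f w' :=
  funext fun _ => (mem_smoothClassAt_iff.1 hf).1 w w' h _

lemma exists_isPiece {n : ℕ} {f : C(Space D, ℝ)} (hf : f ∈ smoothClassAt D n) (w : cantor D)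
    {x : ℝ} (hx : x ∈ Icc (0 : ℝ) 1) (hxn : x ∉ nodes D n) :
    ∃ a b, x ∈ Ioo a b ∧ IsPiece (hat D f w) a b := by
  obtain ⟨a, ha, b, hb, hab, hx, hd⟩ := exists_gap D n hx hxn
  exact ⟨a, b, hx, (mem_smoothClassAt_iff.1 hf).2 w a ha b hb hab hd⟩

/-- Up to the cell of `w`, only finitely many pairs of a cell and a gap occur, and each contributes
a finite bound. -/
lemma exists_deriv_bound {n : ℕ} {f : C(Space D, ℝ)} (hf : f ∈ smoothClassAt D n) :
    ∃ C, 0 ≤ C ∧ ∀ w, ∀ x ∈ Icc (0 : ℝ) 1, x ∉ nodes D n → |deriv (hat D f w) x| ≤ C := by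
  obtain ⟨S, hS, hcov⟩ := exists_finite_sameCell D n
  -- The bound is stated for all triples, with the default 0 for those that are not gaps, so that a
  -- total function `C` can be chosen.
  have key : ∀ i : cantor D × ℝ × ℝ, ∃ C, i.2.1 ∈ nodes D n → i.2.2 ∈ nodes D n →
      i.2.1 < i.2.2 → Disjoint (Ioo i.2.1 i.2.2) (nodes D n) →
      ∀ x ∈ Ioo i.2.1 i.2.2, |deriv (hat D f i.1) x| ≤ C := by
    rintro ⟨w, a, b⟩
    by_cases h : a ∈ nodes D n ∧ b ∈ nodes D n ∧ a < b ∧ Disjoint (Ioo a b) (nodes D n)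
    · obtain ⟨ha, hb, hab, hd⟩ := h
      obtain ⟨C, hC⟩ := ((mem_smoothClassAt_iff.1 hf).2 w a ha b hb hab hd).exists_bound
      exact ⟨C, fun _ _ _ _ => hC⟩
    · exact ⟨0, fun ha hb hab hd => absurd ⟨ha, hb, hab, hd⟩ h⟩
  choose C hC using key
  obtain ⟨M, hM⟩ := ((hS.prod ((finite_nodes D n).prod (finite_nodes D n))).image C).bddAbove
  refine ⟨max M 0, le_max_right _ _, fun w x hx hxn => ?_⟩
  obtain ⟨w', hw', hc⟩ := hcov w
  obtain ⟨a, ha, b, hb, hab, hx, hd⟩ := exists_gap D n hx hxn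
  rw [hat_eq_of_sameCell hf hc]
  exact ((hC (w', a, b) ha hb hab hd x hx).trans
    (hM (mem_image_of_mem C ⟨hw', ha, hb⟩))).trans (le_max_left _ _)

variable (D) in
lemma ae_notMem_nodes (n : ℕ) : ∀ᵐ x : ℝ, x ∉ nodes D n :=
  (finite_nodes D n).countable.ae_notMem _

lemma intervalIntegrable_deriv_hat {f : C(Space D, ℝ)} (hf : f ∈ smoothClass D) (w : cantor D)
    {a b : ℝ} (ha : a ∈ Icc (0 : ℝ) 1) (hb : b ∈ Icc (0 : ℝ) 1) :
    IntervalIntegrable (deriv (hat D f w)) volume a b := by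
  obtain ⟨n, hf⟩ := mem_iUnion.1 hf
  obtain ⟨C, hC0, hC⟩ := exists_deriv_bound hf
  rw [intervalIntegrable_iff]
  refine Measure.integrableOn_of_bounded (M := C) (by simp)
    (measurable_deriv _).aestronglyMeasurable ?_
  rw [ae_restrict_iff' measurableSet_uIoc]
  filter_upwards [ae_notMem_nodes D n] with x hx hxab
  exact hC w x (uIcc_subset_Icc ha hb (uIoc_subset_uIcc hxab)) hx

/-- The fundamental theorem of calculus tolerates the finitely many nodes because `hat D f w` is
continuous across them. -/
lemma integral_deriv_hat {f : C(Space D, ℝ)} (hf : f ∈ smoothClass D) (w : cantor D)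
    {a b : ℝ} (ha : a ∈ Icc (0 : ℝ) 1) (hb : b ∈ Icc (0 : ℝ) 1) :
    ∫ x in a..b, deriv (hat D f w) x = hat D f w b - hat D f w a := by
  obtain ⟨n, hfn⟩ := mem_iUnion.1 hf
  refine integral_eq_of_hasDerivAt_off_countable _ _ (finite_nodes D n).countable
    (continuous_hat D f w).continuousOn (fun x hx => ?_) (intervalIntegrable_deriv_hat hf w ha hb)
  have hx' : x ∈ Icc (0 : ℝ) 1 := uIcc_subset_Icc ha hb (Ioo_subset_Icc_self hx.1)
  obtain ⟨c, d, hxcd, hp⟩ := exists_isPiece hfn w hx' hx.2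
  exact (hp.differentiableAt hxcd).hasDerivAt

lemma abs_hat_sub_le {n : ℕ} {f : C(Space D, ℝ)} (hf : f ∈ smoothClassAt D n) {C : ℝ}
    (hC : ∀ w, ∀ x ∈ Icc (0 : ℝ) 1, x ∉ nodes D n → |deriv (hat D f w) x| ≤ C) (w : cantor D)
    {a b : ℝ} (ha : a ∈ Icc (0 : ℝ) 1) (hb : b ∈ Icc (0 : ℝ) 1) :
    |hat D f w b - hat D f w a| ≤ C * |b - a| := by
  rw [← integral_deriv_hat (mem_iUnion.2 ⟨n, hf⟩) w ha hb]
  refine intervalIntegral.norm_integral_le_of_norm_le_const_ae (E := ℝ) ?_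
  filter_upwards [ae_notMem_nodes D n] with x hx hxab
  exact hC w x (uIcc_subset_Icc ha hb (uIoc_subset_uIcc hxab)) hx

/-! ### The derivative as a function on the Laakso space -/

open Classical in
/-- The derivative of `f ∈ 𝒢_n` as a function on `L`, vanishing over the nodes of level `n`. -/
def derivFun {n : ℕ} {f : C(Space D, ℝ)} (hf : f ∈ smoothClassAt D n) : Space D → ℝ :=
  lift D (fun p => if (p.1 : ℝ) ∈ nodes D n then 0 else deriv (hat D f p.2) (p.1 : ℝ))
    fun p q h => by
      rw [← fst_eq_of_glued D h]
      split_ifs with hp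
      · rfl
      · rw [hat_eq_of_sameCell hf (h.sameCell hp)]

lemma derivFun_of_mem {n : ℕ} {f : C(Space D, ℝ)} (hf : f ∈ smoothClassAt D n) {q : Space D}
    (hq : coord D q ∈ nodes D n) : derivFun hf q = 0 := by
  obtain ⟨p, rfl⟩ := surjective_proj D q
  exact if_pos hq

lemma derivFun_proj {n : ℕ} {f : C(Space D, ℝ)} (hf : f ∈ smoothClassAt D n)
    {p : unitInterval × cantor D} (hp : (p.1 : ℝ) ∉ nodes D n) :
    derivFun hf (proj D p) = deriv (hat D f p.2) (p.1 : ℝ) :=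
  if_neg hp

lemma eq_hat_of_mem_column {n : ℕ} {f : C(Space D, ℝ)} (hf : f ∈ smoothClassAt D n)
    {w : cantor D} {q : Space D} (hq : q ∈ column D n w) :
    f q = hat D f w (coord D q) ∧ derivFun hf q = deriv (hat D f w) (coord D q) := by
  obtain ⟨p, rfl⟩ := surjective_proj D q
  obtain ⟨h1, h2⟩ := (proj_mem_column D).1 hq
  rw [derivFun_proj hf h1, coord_proj, ← hat_eq_of_sameCell hf h2, hat_coe]
  exact ⟨rfl, rfl⟩

lemma continuousOn_derivFun {n : ℕ} {f : C(Space D, ℝ)} (hf : f ∈ smoothClassAt D n) :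
    ContinuousOn (derivFun hf) (coord D ⁻¹' nodes D n)ᶜ := by
  intro q hq
  refine ContinuousAt.continuousWithinAt ?_
  obtain ⟨⟨x, w⟩, rfl⟩ := surjective_proj D q
  have hx : (x : ℝ) ∉ nodes D n := hq
  have hcol : proj D (x, w) ∈ column D n w := ⟨hx, fun _ _ => rfl⟩
  obtain ⟨a, b, hxab, hp⟩ := exists_isPiece hf w x.2 hx
  refine ContinuousAt.congr (f := fun q => deriv (hat D f w) (coord D q)) ?_ ?_
  · exact ContinuousAt.comp (x := proj D (x, w)) (g := deriv (hat D f w))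
      (hp.continuousAt_deriv hxab) (continuous_coord D).continuousAt
  · filter_upwards [(isOpen_column D n w).mem_nhds hcol] with q hq
    exact (eq_hat_of_mem_column hf hq).2.symm

variable (D) in
lemma measurableSet_coord_preimage_nodes (n : ℕ) : MeasurableSet (coord D ⁻¹' nodes D n) :=
  ((finite_nodes D n).isClosed.preimage (continuous_coord D)).measurableSet

lemma measurable_derivFun {n : ℕ} {f : C(Space D, ℝ)} (hf : f ∈ smoothClassAt D n) :
    Measurable (derivFun hf) := by
  classical
  have h := ContinuousOn.measurable_piecewise (f := fun _ : Space D => (0 : ℝ))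
    continuousOn_const (continuousOn_derivFun hf) (measurableSet_coord_preimage_nodes D n)
  convert h using 1
  funext q
  by_cases hq : q ∈ coord D ⁻¹' nodes D n
  · rw [piecewise_eq_of_mem _ _ _ hq]
    exact derivFun_of_mem hf hq
  · rw [piecewise_eq_of_notMem _ _ _ hq]

variable (D) in
/-- The product of Lebesgue measure on `[0, 1]` and the Bernoulli measure on `K`. -/
abbrev prodMeasure : Measure (unitInterval × cantor D) :=
  (volume : Measure unitInterval).prod (cantorMeasure D)

variable (D) in
lemma measurePreserving_proj : MeasurePreserving (proj D) (prodMeasure D) (mu D) :=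
  ⟨(continuous_proj D).measurable, rfl⟩

variable (D) in
lemma ae_fst_notMem_nodes (n : ℕ) : ∀ᵐ p ∂prodMeasure D, (p.1 : ℝ) ∉ nodes D n := by
  have h : ∀ᵐ x : unitInterval, (x : ℝ) ∉ nodes D n := by
    have h1 : ((fun x : unitInterval => (x : ℝ)) ⁻¹' nodes D n).Finite :=
      (finite_nodes D n).preimage Subtype.val_injective.injOn
    exact h1.countable.ae_notMem _
  exact Measure.quasiMeasurePreserving_fst.ae h

lemma abs_derivFun_le {n : ℕ} {f : C(Space D, ℝ)} (hf : f ∈ smoothClassAt D n) {C : ℝ}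
    (hC0 : 0 ≤ C) (hC : ∀ w, ∀ x ∈ Icc (0 : ℝ) 1, x ∉ nodes D n → |deriv (hat D f w) x| ≤ C)
    (q : Space D) : |derivFun hf q| ≤ C := by
  by_cases hq : coord D q ∈ nodes D n
  · rw [derivFun_of_mem hf hq]
    simpa
  · obtain ⟨p, rfl⟩ := surjective_proj D q
    rw [derivFun_proj hf hq]
    exact hC _ _ p.1.2 hq

lemma memLp_derivFun {n : ℕ} {f : C(Space D, ℝ)} (hf : f ∈ smoothClassAt D n) :
    MemLp (derivFun hf) 2 (mu D) := by
  obtain ⟨C, hC0, hC⟩ := exists_deriv_bound hf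
  exact MemLp.of_bound (measurable_derivFun hf).aestronglyMeasurable C
    (ae_of_all _ (abs_derivFun_le hf hC0 hC))

lemma isSmoothXDeriv_toLp {n : ℕ} {f : C(Space D, ℝ)} (hf : f ∈ smoothClassAt D n) :
    IsSmoothXDeriv D f ((memLp_derivFun hf).toLp _) := by
  filter_upwards [(measurePreserving_proj D).quasiMeasurePreserving.ae
    (memLp_derivFun hf).coeFn_toLp, ae_fst_notMem_nodes D n] with p h1 h2
  rw [h1, derivFun_proj hf h2]

lemma exists_isSmoothXDeriv {f : C(Space D, ℝ)} (hf : f ∈ smoothClass D) :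
    ∃ d, IsSmoothXDeriv D f d := by
  obtain ⟨n, hf⟩ := mem_iUnion.1 hf
  exact ⟨_, isSmoothXDeriv_toLp hf⟩

/-- The measure on L is a pushforward, so for a measurable property it suffices to check it
upstairs. -/
lemma ae_mu_of_ae_prod {P : Space D → Prop} (hP : MeasurableSet {q | P q})
    (h : ∀ᵐ p ∂prodMeasure D, P (proj D p)) : ∀ᵐ q ∂mu D, P q :=
  (ae_map_iff (continuous_proj D).measurable.aemeasurable hP).2 h

lemma IsSmoothXDeriv.unique {f : C(Space D, ℝ)} {d d' : L2 D} (h : IsSmoothXDeriv D f d)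
    (h' : IsSmoothXDeriv D f d') : d = d' := by
  refine Lp.ext (ae_mu_of_ae_prod (measurableSet_eq_fun (Lp.stronglyMeasurable d).measurable
    (Lp.stronglyMeasurable d').measurable) ?_)
  filter_upwards [h, h'] with p h1 h2
  rw [h1, h2]

lemma smoothClass_common {f g : C(Space D, ℝ)} (hf : f ∈ smoothClass D) (hg : g ∈ smoothClass D) :
    ∃ n, f ∈ smoothClassAt D n ∧ g ∈ smoothClassAt D n := by
  obtain ⟨m, hf⟩ := mem_iUnion.1 hf
  obtain ⟨n, hg⟩ := mem_iUnion.1 hg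
  exact ⟨max m n, smoothClassAt_mono (le_max_left _ _) hf, smoothClassAt_mono (le_max_right _ _) hg⟩

variable (D) in
lemma ae_differentiableAt_hat {f : C(Space D, ℝ)} (hf : f ∈ smoothClass D) :
    ∀ᵐ p ∂prodMeasure D, DifferentiableAt ℝ (hat D f p.2) (p.1 : ℝ) := by
  obtain ⟨n, hf⟩ := mem_iUnion.1 hf
  filter_upwards [ae_fst_notMem_nodes D n] with p hp
  obtain ⟨a, b, hx, hpc⟩ := exists_isPiece hf p.2 p.1.2 hp
  exact hpc.differentiableAt hx

lemma add_mem_smoothClass {f g : C(Space D, ℝ)} (hf : f ∈ smoothClass D) (hg : g ∈ smoothClass D) :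
    f + g ∈ smoothClass D := by
  obtain ⟨n, hf, hg⟩ := smoothClass_common hf hg
  exact mem_iUnion.2 ⟨n, add_mem_smoothClassAt hf hg⟩

lemma postcomp_mem_smoothClass {f : C(Space D, ℝ)} (hf : f ∈ smoothClass D) {ψ : ℝ → ℝ}
    (hψ : ContDiff ℝ 1 ψ) : postcomp hψ.continuous f ∈ smoothClass D := by
  obtain ⟨n, hf⟩ := mem_iUnion.1 hf
  exact mem_iUnion.2 ⟨n, postcomp_mem_smoothClassAt hf hψ⟩

lemma smul_mem_smoothClass (c : ℝ) {f : C(Space D, ℝ)} (hf : f ∈ smoothClass D) :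
    c • f ∈ smoothClass D := by
  obtain ⟨n, hf⟩ := mem_iUnion.1 hf
  exact mem_iUnion.2 ⟨n, smul_mem_smoothClassAt c hf⟩

lemma IsSmoothXDeriv.add {f g : C(Space D, ℝ)} (hf : f ∈ smoothClass D) (hg : g ∈ smoothClass D)
    {d e : L2 D} (hd : IsSmoothXDeriv D f d) (he : IsSmoothXDeriv D g e) :
    IsSmoothXDeriv D (f + g) (d + e) := by
  filter_upwards [hd, he, (measurePreserving_proj D).quasiMeasurePreserving.ae
    (Lp.coeFn_add d e), ae_differentiableAt_hat D hf, ae_differentiableAt_hat D hg]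
    with p h1 h2 h3 h4 h5
  rw [h3, Pi.add_apply, h1, h2]
  exact (deriv_add h4 h5).symm

lemma IsSmoothXDeriv.postcomp {f : C(Space D, ℝ)} (hf : f ∈ smoothClass D) {d e : L2 D}
    (hd : IsSmoothXDeriv D f d) {ψ : ℝ → ℝ} (hψ : ContDiff ℝ 1 ψ)
    (he : ∀ᵐ q ∂mu D, e q = deriv ψ (f q) * d q) :
    IsSmoothXDeriv D (postcomp hψ.continuous f) e := by
  filter_upwards [hd, (measurePreserving_proj D).quasiMeasurePreserving.ae he,
    ae_differentiableAt_hat D hf] with p h1 h2 h3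
  rw [h2, h1]
  have := deriv_comp (p.1 : ℝ) (hψ.differentiable one_ne_zero (hat D f p.2 p.1)) h3
  rw [hat_coe] at this
  exact this.symm

lemma IsSmoothXDeriv.smul {f : C(Space D, ℝ)} (hf : f ∈ smoothClass D) (c : ℝ) {d : L2 D}
    (hd : IsSmoothXDeriv D f d) : IsSmoothXDeriv D (c • f) (c • d) := by
  have hψ : ContDiff ℝ 1 fun x : ℝ => c * x := contDiff_const.mul contDiff_id
  refine hd.postcomp hf hψ ?_
  filter_upwards [Lp.coeFn_smul c d] with q hq
  rw [hq]
  simp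

/-! ### Upper gradients of smooth functions -/

/-- Near each point of `L` a function of `𝒢_n` is controlled by the `[0, 1]`-coordinate, since it
takes only finitely many values on a fibre of the coordinate. -/
lemma eventually_abs_sub_le_coord {n : ℕ} {f : C(Space D, ℝ)} (hf : f ∈ smoothClassAt D n) {C : ℝ}
    (hC : ∀ w, ∀ x ∈ Icc (0 : ℝ) 1, x ∉ nodes D n → |deriv (hat D f w) x| ≤ C) (q : Space D) :
    ∀ᶠ y in 𝓝 q, |f y - f q| ≤ C * |coord D y - coord D q| := by
  obtain ⟨⟨x₀, w₀⟩, rfl⟩ := surjective_proj D q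
  obtain ⟨S, hS, hcov⟩ := exists_finite_sameCell D n
  set q := proj D (x₀, w₀)
  -- These are the values of `f` on the fibre over `x₀` other than `f q`. There are finitely many,
  -- so some δ separates them from `f q`.
  have hV : (((fun w => f (proj D (x₀, w))) '' S) \ {f q}).Finite := (hS.image _).sdiff
  obtain ⟨δ, hδ, hball⟩ := Metric.isOpen_iff.1 hV.isClosed.isOpen_compl (f q) (by simp)
  have hgap : ∀ w, |f (proj D (x₀, w)) - f q| < δ → f (proj D (x₀, w)) = f q := by
    intro w hw
    obtain ⟨w', hw', hc⟩ := hcov w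
    have h1 := (mem_smoothClassAt_iff.1 hf).1 w w' hc x₀
    by_contra hne
    refine hball (show f (proj D (x₀, w)) ∈ Metric.ball (f q) δ from hw) ⟨⟨w', hw', h1.symm⟩, hne⟩
  have e1 : ∀ᶠ y in 𝓝 q, |f y - f q| < δ / 2 := by
    have : Tendsto (fun y => |f y - f q|) (𝓝 q) (𝓝 |f q - f q|) :=
      ((f.continuous.sub continuous_const).abs).tendsto q
    exact this.eventually (gt_mem_nhds (by simp [hδ]))
  have e2 : ∀ᶠ y in 𝓝 q, C * |coord D y - coord D q| < δ / 2 := by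
    have : Tendsto (fun y => C * |coord D y - coord D q|) (𝓝 q)
        (𝓝 (C * |coord D q - coord D q|)) :=
      (continuous_const.mul ((continuous_coord D).sub continuous_const).abs).tendsto q
    exact this.eventually (gt_mem_nhds (by simp [hδ]))
  filter_upwards [e1, e2] with y h1 h2
  obtain ⟨⟨x, w⟩, rfl⟩ := surjective_proj D y
  have h3 := abs_hat_sub_le hf hC w x₀.2 x.2
  rw [hat_coe, hat_coe] at h3
  -- Sliding along the sheet of `w` from `x` back to `x₀` changes `f` by less than δ/2, and `f y` is
  -- within δ/2 of `f q`. The value reached on the fibre is therefore `f q` itself.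
  have h4 : f (proj D (x₀, w)) = f q := by
    refine hgap w ?_
    have h5 : |f (proj D (x₀, w)) - f q| ≤
        |f (proj D (x, w)) - f (proj D (x₀, w))| + |f (proj D (x, w)) - f q| := by
      rw [abs_sub_comm (f (proj D (x, w))) (f (proj D (x₀, w)))]
      exact abs_sub_le _ _ _
    have h6 : C * |(x : ℝ) - x₀| < δ / 2 := h2
    linarith
  rw [← h4]
  exact h3

/-- A mean value inequality for right slopes: the local bound holds near each point with no
uniformity, but bounding the lower right slope by C at each point of [a, b) is enough. -/
lemma sub_le_of_eventually_abs_sub_le {F : ℝ → ℝ} {C a b : ℝ} (hF : ContinuousOn F (Icc a b))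
    (h : ∀ s ∈ Ico a b, ∀ᶠ z in 𝓝[>] s, |F z - F s| ≤ C * |z - s|) :
    ∀ ⦃s⦄, s ∈ Icc a b → F s ≤ F a + C * (s - a) := by
  refine image_le_of_liminf_slope_right_le_deriv_boundary (B' := fun _ => C) hF (by simp)
    (by fun_prop) (fun s _ => ?_) fun s hs r hr => ?_
  · have := (((hasDerivAt_id s).sub_const a).const_mul C).const_add (F a)
    simpa using this.hasDerivWithinAt
  · refine Eventually.frequently ?_
    filter_upwards [h s hs, self_mem_nhdsWithin] with z hz hsz
    have hsz : 0 < z - s := sub_pos.2 hsz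
    rw [slope_def_field, div_lt_iff₀ hsz]
    rw [abs_of_pos hsz] at hz
    nlinarith [le_abs_self (F z - F s)]

lemma abs_sub_le_of_eventually {F : ℝ → ℝ} {C a b : ℝ} (hab : a ≤ b) (hF : ContinuousOn F (Icc a b))
    (h : ∀ s ∈ Ico a b, ∀ᶠ z in 𝓝[>] s, |F z - F s| ≤ C * |z - s|) :
    |F b - F a| ≤ C * (b - a) := by
  have h1 := sub_le_of_eventually_abs_sub_le hF h (right_mem_Icc.2 hab)
  have h2 := sub_le_of_eventually_abs_sub_le (F := fun s => -F s) hF.neg (fun s hs => by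
    filter_upwards [h s hs] with z hz
    rwa [neg_sub_neg, abs_sub_comm (F s)]) (right_mem_Icc.2 hab)
  rw [abs_le]
  constructor <;> linarith

/-- An increment is at most the variation, which for unit speed is the parameter length. -/
lemma abs_sub_le_of_hasUnitSpeedOn {x : ℝ → ℝ} {S : Set ℝ} (h : HasUnitSpeedOn x S) {a b : ℝ}
    (ha : a ∈ S) (hb : b ∈ S) : |x b - x a| ≤ |b - a| := by
  wlog hab : a ≤ b generalizing a b
  · rw [abs_sub_comm, abs_sub_comm b]
    exact this hb ha (le_of_not_ge hab)
  have h1 := eVariationOn.edist_le x (s := S ∩ Icc a b) ⟨hb, hab, le_rfl⟩ ⟨ha, le_rfl, hab⟩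
  rw [h ha hb, edist_dist, Real.dist_eq, NNReal.coe_one, one_mul] at h1
  rw [abs_of_nonneg (sub_nonneg.2 hab)]
  exact (ENNReal.ofReal_le_ofReal_iff (sub_nonneg.2 hab)).1 h1

/-- This replaces the chain rule, since the coordinate `x` of a curve need not be differentiable at
`s`. It moves at speed at most 1, so increments of `F` are at most (|d| + ε)|z - s|. Where `F` is
not differentiable, `deriv F s` is 0. -/
lemma abs_deriv_le_of_comp {F h x : ℝ → ℝ} {s d : ℝ} (hh : HasDerivAt h d (x s))
    (hxc : ContinuousAt x s) (hx : ∀ᶠ z in 𝓝 s, |x z - x s| ≤ |z - s|)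
    (hF : ∀ᶠ z in 𝓝 s, F z = h (x z)) : |deriv F s| ≤ |d| := by
  by_cases hd : DifferentiableAt ℝ F s
  swap
  · rw [deriv_zero_of_not_differentiableAt hd]
    simp
  refine le_of_forall_pos_le_add fun ε hε => ?_
  refine hd.hasDerivAt.le_of_lip' (by positivity) ?_
  have h1 := hxc.eventually ((hasDerivAt_iff_isLittleO.1 hh).def hε)
  filter_upwards [h1, hx, hF] with z h1 h2 h3
  rw [h3, hF.self_of_nhds]
  simp only [Real.norm_eq_abs, smul_eq_mul] at h1 ⊢
  have h4 : |h (x z) - h (x s)| ≤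
      |h (x z) - h (x s) - (x z - x s) * d| + |x z - x s| * |d| := by
    rw [← abs_mul]
    calc |h (x z) - h (x s)| = |(h (x z) - h (x s) - (x z - x s) * d) + (x z - x s) * d| := by
          ring_nf
      _ ≤ _ := abs_add_le _ _
  nlinarith [abs_nonneg d, abs_nonneg (x z - x s), abs_nonneg (z - s)]

open Classical in
/-- The upper gradient `|∂f/∂x|` of `f ∈ 𝒢_n`, with the value `C` over the nodes of level `n`. -/
def gradFun {n : ℕ} {f : C(Space D, ℝ)} (hf : f ∈ smoothClassAt D n) (C : ℝ) (q : Space D) :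
    ℝ≥0∞ :=
  if coord D q ∈ nodes D n then ENNReal.ofReal C else ENNReal.ofReal |derivFun hf q|

lemma measurable_gradFun {n : ℕ} {f : C(Space D, ℝ)} (hf : f ∈ smoothClassAt D n) (C : ℝ) :
    Measurable (gradFun hf C) :=
  Measurable.ite (measurableSet_coord_preimage_nodes D n) measurable_const
    (ENNReal.measurable_ofReal.comp (measurable_derivFun hf).abs)

/-- Along an arc length curve `f` is C-Lipschitz, hence the integral of its derivative. Off the
nodes that derivative is at most |∂f/∂x|. Over the nodes only the bound C is used, which avoids any
analysis of how a curve meets or crosses wormholes. -/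
theorem isUpperGradient_gradFun {n : ℕ} {f : C(Space D, ℝ)} (hf : f ∈ smoothClassAt D n) {C : ℝ}
    (hC0 : 0 ≤ C) (hC : ∀ w, ∀ x ∈ Icc (0 : ℝ) 1, x ∉ nodes D n → |deriv (hat D f w) x| ≤ C) :
    IsUpperGradient D f (gradFun hf C) := by
  refine ⟨measurable_gradFun hf C, fun l γ ⟨hl, hγ, hspeed⟩ => ?_⟩
  set F : ℝ → ℝ := fun s => f (γ s) with hFdef
  have hF : ContinuousOn F (Icc 0 l) := f.continuous.comp_continuousOn hγ
  have hlip : ∀ s ∈ Icc 0 l, ∀ z ∈ Icc 0 l, |coord D (γ z) - coord D (γ s)| ≤ |z - s| :=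
    fun s hs z hz => abs_sub_le_of_hasUnitSpeedOn hspeed hs hz
  have hloc : ∀ s ∈ Icc 0 l, ∀ᶠ z in 𝓝[Icc 0 l] s, |F z - F s| ≤ C * |z - s| := by
    intro s hs
    filter_upwards [(hγ s hs).eventually (eventually_abs_sub_le_coord hf hC (γ s)),
      self_mem_nhdsWithin] with z hz hz'
    exact hz.trans (mul_le_mul_of_nonneg_left (hlip s hs z hz') hC0)
  have hlipF : LipschitzOnWith C.toNNReal F (uIcc 0 l) := by
    rw [uIcc_of_le hl]
    refine LipschitzOnWith.of_dist_le_mul fun a ha b hb => ?_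
    rw [Real.coe_toNNReal C hC0, Real.dist_eq, Real.dist_eq]
    have key : ∀ a ∈ Icc 0 l, ∀ b ∈ Icc 0 l, a ≤ b → |F b - F a| ≤ C * (b - a) := by
      intro a ha b hb hab
      refine abs_sub_le_of_eventually hab (hF.mono (Icc_subset_Icc ha.1 hb.2)) fun s hs => ?_
      have hs' : s ∈ Icc 0 l := ⟨ha.1.trans hs.1, hs.2.le.trans hb.2⟩
      refine Filter.Eventually.filter_mono ?_ (hloc s hs')
      refine nhdsWithin_le_iff.2 ?_
      filter_upwards [Ioo_mem_nhdsGT (hs.2.trans_le hb.2)] with z hz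
      exact ⟨hs'.1.trans hz.1.le, hz.2.le⟩
    rcases le_total a b with hab | hab
    · rw [abs_sub_comm, abs_sub_comm a, abs_of_nonneg (sub_nonneg.2 hab)]
      exact key a ha b hb hab
    · rw [abs_of_nonneg (sub_nonneg.2 hab)]
      exact key b hb a ha hab
  have hAC := hlipF.absolutelyContinuousOnInterval
  have hint := hAC.integral_deriv_eq_sub
  have hgrad : ∀ s ∈ Ioo 0 l, ENNReal.ofReal |deriv F s| ≤ gradFun hf C (γ s) := by
    intro s hs
    have hnhds : Icc 0 l ∈ 𝓝 s := Icc_mem_nhds hs.1 hs.2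
    have hs' := Ioo_subset_Icc_self hs
    unfold gradFun
    split_ifs with hnode
    -- Over a node only the local Lipschitz bound is available, and it is exactly the value C of
    -- `gradFun`.
    · refine ENNReal.ofReal_le_ofReal ?_
      by_cases hd : DifferentiableAt ℝ F s
      · refine hd.hasDerivAt.le_of_lip' hC0 ?_
        have := hloc s hs'
        rwa [nhdsWithin_eq_nhds.2 hnhds] at this
      · rwa [deriv_zero_of_not_differentiableAt hd, abs_zero]
    · refine ENNReal.ofReal_le_ofReal ?_
      obtain ⟨⟨x, w⟩, hq⟩ := surjective_proj D (γ s)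
      have hx : (x : ℝ) = coord D (γ s) := by rw [← hq]; rfl
      have hcol : γ s ∈ column D n w := by
        rw [← hq]
        exact ⟨by rwa [hx], fun _ _ => rfl⟩
      have hxI : coord D (γ s) ∈ Icc (0 : ℝ) 1 := by rw [← hx]; exact x.2
      rw [(eq_hat_of_mem_column hf hcol).2]
      obtain ⟨a, b, hab, hp⟩ := exists_isPiece hf w hxI hnode
      have hγs : ContinuousAt γ s := hγ.continuousAt hnhds
      -- Near `s` the curve stays in one column, where `f` is `hat D f w` composed with the
      -- coordinate.
      refine abs_deriv_le_of_comp (x := fun s => coord D (γ s)) (h := hat D f w)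
        (hp.differentiableAt hab).hasDerivAt
        ((continuous_coord D).continuousAt.comp hγs) ?_ ?_
      · filter_upwards [hnhds] with z hz using hlip s hs' z hz
      · filter_upwards [hγs.eventually ((isOpen_column D n w).mem_nhds hcol)] with z hz
        exact (eq_hat_of_mem_column hf hz).1
  calc ENNReal.ofReal |f (γ 0) - f (γ l)| = ENNReal.ofReal ‖∫ s in 0..l, deriv F s‖ := by
        rw [hint, Real.norm_eq_abs, abs_sub_comm]
    _ ≤ ∫⁻ s in Ioc 0 l, ENNReal.ofReal |deriv F s| := by
        rw [intervalIntegral.integral_of_le hl, ofReal_norm]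
        refine (enorm_integral_le_lintegral_enorm _).trans (le_of_eq ?_)
        simp only [← ofReal_norm, Real.norm_eq_abs]
    _ = ∫⁻ s in Ioo 0 l, ENNReal.ofReal |deriv F s| := (setLIntegral_congr Ioo_ae_eq_Ioc).symm
    _ ≤ ∫⁻ s in Ioo 0 l, gradFun hf C (γ s) :=
        setLIntegral_mono' measurableSet_Ioo hgrad
    _ ≤ ∫⁻ s in Icc 0 l, gradFun hf C (γ s) :=
        lintegral_mono_set Ioo_subset_Icc_self

/-- Every `f ∈ 𝒢` has an upper gradient that agrees with `|∂f/∂x|` almost everywhere. -/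
theorem exists_isUpperGradient {f : C(Space D, ℝ)} (hf : f ∈ smoothClass D) {d : L2 D}
    (hd : IsSmoothXDeriv D f d) :
    ∃ g, IsUpperGradient D f g ∧ g =ᵐ[mu D] fun q => ENNReal.ofReal |d q| := by
  obtain ⟨n, hf⟩ := mem_iUnion.1 hf
  obtain ⟨C, hC0, hC⟩ := exists_deriv_bound hf
  refine ⟨gradFun hf C, isUpperGradient_gradFun hf hC0 hC, ?_⟩
  rw [hd.unique (isSmoothXDeriv_toLp hf)]
  have hnode : ∀ᵐ q ∂mu D, coord D q ∉ nodes D n :=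
    ae_mu_of_ae_prod (measurableSet_coord_preimage_nodes D n).compl (ae_fst_notMem_nodes D n)
  filter_upwards [(memLp_derivFun hf).coeFn_toLp, hnode] with q h1 h2
  rw [h1, gradFun, if_neg h2]

/-! ### Vertical curves -/

lemma isArcLengthCurve_vertical (w : cantor D) {a b : ℝ} (ha : 0 ≤ a) (hab : a ≤ b) (hb : b ≤ 1) :
    IsArcLengthCurve D (b - a) fun s => proj D (projIcc 0 1 zero_le_one (a + s), w) := by
  have hcoord : EqOn (coord D ∘ fun s => proj D (projIcc 0 1 zero_le_one (a + s), w))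
      (fun s => a + s) (Icc 0 (b - a)) := by
    intro s hs
    have h1 : a + s ∈ Icc (0 : ℝ) 1 := ⟨by linarith [hs.1], by linarith [hs.2]⟩
    simp only [Function.comp_apply, coord_proj, projIcc_of_mem _ h1]
  refine ⟨sub_nonneg.2 hab, ((continuous_proj D).comp ((continuous_projIcc.comp
    (continuous_const.add continuous_id)).prodMk continuous_const)).continuousOn, ?_⟩
  refine hasConstantSpeedOnWith_iff_ordered.2 fun x hx y hy hxy => ?_
  rw [eVariationOn.congr (hcoord.mono inter_subset_left), NNReal.coe_one, one_mul]
  have hmono : MonotoneOn (fun s : ℝ => a + s) (Icc 0 (b - a)) :=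
    fun s _ z _ h => add_le_add_right h a
  rw [hmono.eVariationOn_eq hx hy, add_sub_add_left_eq_sub]

/-- The upper gradient inequality on a segment of [0, 1] × {w}, with the parameter translated from
[0, b - a] to [a, b]. -/
lemma IsUpperGradient.abs_sub_le {f : Space D → ℝ} {g : Space D → ℝ≥0∞}
    (h : IsUpperGradient D f g) (w : cantor D) {a b : ℝ} (ha : 0 ≤ a) (hab : a ≤ b) (hb : b ≤ 1) :
    ENNReal.ofReal |f (proj D (projIcc 0 1 zero_le_one a, w)) -
        f (proj D (projIcc 0 1 zero_le_one b, w))| ≤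
      ∫⁻ x in Icc a b, g (proj D (projIcc 0 1 zero_le_one x, w)) := by
  have h1 := h.2 _ _ (isArcLengthCurve_vertical w ha hab hb)
  simp only [add_zero, add_sub_cancel] at h1
  refine h1.trans (le_of_eq ?_)
  have h2 := (measurePreserving_add_left volume a).setLIntegral_comp_preimage_emb
    (measurableEmbedding_addLeft a)
    (fun x => g (proj D (projIcc 0 1 zero_le_one x, w))) (Icc a b)
  simpa using h2

/-! ### Lower bounds for generalized upper gradients -/

/-- A function whose integrals over almost all intervals are nonnegative is nonnegative. -/
lemma ae_nonneg_of_integral_nonneg {h : ℝ → ℝ} (hh : IntervalIntegrable h volume 0 1) {P : ℝ → Prop}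
    (hP : ∀ᵐ x, x ∈ Icc (0 : ℝ) 1 → P x)
    (hint : ∀ a ∈ Icc (0 : ℝ) 1, ∀ b ∈ Icc (0 : ℝ) 1, P a → P b → a ≤ b → 0 ≤ ∫ x in a..b, h x) :
    ∀ᵐ x, x ∈ Icc (0 : ℝ) 1 → 0 ≤ h x := by
  filter_upwards [hh.ae_hasDerivAt_integral, hP, (countable_singleton (1 : ℝ)).ae_notMem volume]
    with x hx hPx hx1 hxI
  have hxlt : x < 1 := lt_of_le_of_ne hxI.2 hx1
  have h01 : (0 : ℝ) ∈ uIcc (0 : ℝ) 1 := left_mem_uIcc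
  have hder := hx (by rwa [uIcc_of_le zero_le_one]) 0 h01
  have hslope := hder.hasDerivWithinAt (s := Ioi x)
  rw [hasDerivWithinAt_iff_tendsto_slope' self_notMem_Ioi] at hslope
  -- The derivative of the primitive exists at `x`, so its sign can be tested along right difference
  -- quotients with endpoints in the full-measure set `P`.
  refine ge_of_tendsto_of_frequently hslope ?_
  intro hcon
  have hmem := mem_nhdsGT_iff_exists_Ioo_subset.1 hcon
  obtain ⟨z, hz, hsub⟩ := hmem
  have hpos : 0 < volume (Ioo x (min z 1)) := by
    rw [Real.volume_Ioo]
    simpa using ⟨hz, hxlt⟩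
  -- Every interval to the right of `x` has positive measure and therefore contains a point of `P`.
  obtain ⟨y, hy, hPy⟩ := (Filter.nonempty_of_mem (f := ae (volume.restrict (Ioo x (min z 1))))
    (hf := ae_neBot.2 (by simpa [Measure.restrict_eq_zero] using hpos.ne'))
    (Filter.inter_mem (self_mem_ae_restrict measurableSet_Ioo) (ae_restrict_of_ae hP)))
  have hy1 : y ∈ Icc (0 : ℝ) 1 := ⟨hxI.1.trans hy.1.le, (hy.2.trans_le (min_le_right _ _)).le⟩
  refine hsub ⟨hy.1, hy.2.trans_le (min_le_left _ _)⟩ ?_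
  have hsubI : ∀ c ∈ Icc (0 : ℝ) 1, IntervalIntegrable h volume 0 c := fun c hc =>
    hh.mono_set (by rw [uIcc_of_le hc.1, uIcc_of_le zero_le_one]; exact Icc_subset_Icc_right hc.2)
  beta_reduce
  rw [slope_def_field, intervalIntegral.integral_interval_sub_left (hsubI y hy1) (hsubI x hxI)]
  exact div_nonneg (hint x hxI y hy1 (hPx hxI) (hPy hy1) hy.1.le) (sub_nonneg.2 hy.1.le)

/-- Apply the one-signed statement to Q - V and to Q + V. -/
lemma ae_abs_le_of_abs_integral_le {V Q : ℝ → ℝ} (hV : IntervalIntegrable V volume 0 1)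
    (hQ : IntervalIntegrable Q volume 0 1) {P : ℝ → Prop} (hP : ∀ᵐ x, x ∈ Icc (0 : ℝ) 1 → P x)
    (hint : ∀ a ∈ Icc (0 : ℝ) 1, ∀ b ∈ Icc (0 : ℝ) 1, P a → P b → a ≤ b →
      |∫ x in a..b, V x| ≤ ∫ x in a..b, Q x) :
    ∀ᵐ x, x ∈ Icc (0 : ℝ) 1 → |V x| ≤ Q x := by
  have hsub : ∀ {G : ℝ → ℝ}, IntervalIntegrable G volume 0 1 → ∀ a ∈ Icc (0 : ℝ) 1,
      ∀ b ∈ Icc (0 : ℝ) 1, IntervalIntegrable G volume a b := fun hG a ha b hb =>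
    hG.mono_set (by rw [uIcc_of_le zero_le_one]; exact uIcc_subset_Icc ha hb)
  have h1 := ae_nonneg_of_integral_nonneg (hQ.sub hV) hP fun a ha b hb hPa hPb hab => by
    rw [intervalIntegral.integral_sub (hsub hQ a ha b hb) (hsub hV a ha b hb)]
    linarith [(abs_le.1 (hint a ha b hb hPa hPb hab)).2]
  have h2 := ae_nonneg_of_integral_nonneg (hQ.add hV) hP fun a ha b hb hPa hPb hab => by
    rw [intervalIntegral.integral_add (hsub hQ a ha b hb) (hsub hV a ha b hb)]
    linarith [(abs_le.1 (hint a ha b hb hPa hPb hab)).1]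
  filter_upwards [h1, h2] with x h1 h2 hx
  exact abs_le.2 ⟨by linarith [h2 hx], by linarith [h1 hx]⟩

/-- The one-dimensional comparison of the derivative with upper gradients, in the limit. -/
lemma ae_abs_le_of_tendsto {V Q : ℝ → ℝ} (hV : IntervalIntegrable V volume 0 1)
    (hQ : IntervalIntegrable Q volume 0 1) {F F' H : ℕ → ℝ → ℝ} {G : ℕ → ℝ → ℝ≥0∞}
    (hF' : ∀ n, IntervalIntegrable (F' n) volume 0 1)
    (hFTC : ∀ n, ∀ a ∈ Icc (0 : ℝ) 1, ∀ b ∈ Icc (0 : ℝ) 1, ∫ x in a..b, F' n x = F n b - F n a)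
    (hG : ∀ n, ∀ a ∈ Icc (0 : ℝ) 1, ∀ b ∈ Icc (0 : ℝ) 1, a ≤ b →
      ENNReal.ofReal |H n a - H n b| ≤ ∫⁻ x in Icc a b, G n x)
    (hGtop : ∀ n, ∀ᵐ x, x ∈ Icc (0 : ℝ) 1 → G n x < ∞) {S : ℕ → ℝ → ℝ≥0∞}
    (hS : ∀ n x, x ∈ Icc (0 : ℝ) 1 →
      S n x = ‖H n x - F n x‖ₑ + ‖(G n x).toReal - Q x‖ₑ + ‖F' n x - V x‖ₑ)
    (hSint : Tendsto (fun n => ∫⁻ x in Icc 0 1, S n x) atTop (𝓝 0))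
    (hSae : ∀ᵐ x, x ∈ Icc (0 : ℝ) 1 → Tendsto (fun n => S n x) atTop (𝓝 0)) :
    ∀ᵐ x, x ∈ Icc (0 : ℝ) 1 → |V x| ≤ Q x := by
  have hQ0 : ∀ᵐ x, x ∈ Icc (0 : ℝ) 1 → 0 ≤ Q x := by
    filter_upwards [hSae] with x hx hxI
    have h1 : Tendsto (fun n => ‖(G n x).toReal - Q x‖ₑ) atTop (𝓝 0) :=
      tendsto_of_tendsto_of_tendsto_of_le_of_le tendsto_const_nhds (hx hxI) (fun n => zero_le)
        fun n => by
          rw [hS n x hxI]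
          exact le_self_add.trans' le_add_self
    have h2 : Tendsto (fun n => (G n x).toReal) atTop (𝓝 (Q x)) := by
      rw [tendsto_iff_edist_tendsto_0]
      simpa only [edist_eq_enorm_sub] using h1
    exact ge_of_tendsto' h2 fun n => ENNReal.toReal_nonneg
  have hsub : ∀ {G : ℝ → ℝ}, IntervalIntegrable G volume 0 1 → ∀ a ∈ Icc (0 : ℝ) 1,
      ∀ b ∈ Icc (0 : ℝ) 1, IntervalIntegrable G volume a b := fun hG a ha b hb =>
    hG.mono_set (by rw [uIcc_of_le zero_le_one]; exact uIcc_subset_Icc ha hb)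
  have hmain : ∀ᵐ x, x ∈ Icc (0 : ℝ) 1 → |V x| ≤ |Q x| := by
    -- Admissible endpoints are those where `S n` tends to 0. This controls the pointwise error of
    -- replacing `F n` by `H n` there, which the integral convergence alone would not.
    refine ae_abs_le_of_abs_integral_le hV hQ.abs hSae fun a ha b hb hPa hPb hab => ?_
    have hsubset : Icc a b ⊆ Icc 0 1 := Icc_subset_Icc ha.1 hb.2
    have hSle : ∀ (T : ℝ → ℝ≥0∞) (n : ℕ), (∀ x ∈ Icc (0 : ℝ) 1, T x ≤ S n x) →
        ∫⁻ x in Icc a b, T x ≤ ∫⁻ x in Icc 0 1, S n x := fun T n hT =>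
      (setLIntegral_mono' measurableSet_Icc fun x hx => hT x (hsubset hx)).trans
        (lintegral_mono_set hsubset)
    have hQint : ∫⁻ x in Icc a b, ‖Q x‖ₑ = ENNReal.ofReal (∫ x in a..b, |Q x|) := by
      rw [intervalIntegral.integral_of_le hab, ← integral_Icc_eq_integral_Ioc,
        ofReal_integral_eq_lintegral_ofReal]
      · simp only [← Real.norm_eq_abs, ofReal_norm]
      · exact ((intervalIntegrable_iff_integrableOn_Icc_of_le hab).1 (hsub hQ a ha b hb)).abs
      · exact ae_of_all _ fun x => abs_nonneg _
    -- Replace V by `F' n`, integrate to an increment of `F n`, pass to `H n` at the endpoints, use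
    -- the upper gradient inequality, and replace `G n` by Q. Each replacement costs a term in `S
    -- n`.
    have hbound : ∀ n, ‖∫ x in a..b, V x‖ₑ ≤ (∫⁻ x in Icc a b, ‖Q x‖ₑ) +
        (S n a + S n b + (∫⁻ x in Icc 0 1, S n x) + ∫⁻ x in Icc 0 1, S n x) := by
      intro n
      have h1 : ‖∫ x in a..b, V x‖ₑ ≤
          ‖∫ x in a..b, F' n x‖ₑ + ‖∫ x in a..b, (F' n x - V x)‖ₑ := by
        rw [intervalIntegral.integral_sub (hsub (hF' n) a ha b hb) (hsub hV a ha b hb)]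
        calc ‖∫ x in a..b, V x‖ₑ = ‖(∫ x in a..b, F' n x) -
              ((∫ x in a..b, F' n x) - ∫ x in a..b, V x)‖ₑ := by rw [sub_sub_cancel]
          _ ≤ _ := enorm_sub_le
      have h2 : ‖∫ x in a..b, (F' n x - V x)‖ₑ ≤ ∫⁻ x in Icc 0 1, S n x := by
        rw [intervalIntegral.integral_of_le hab, ← integral_Icc_eq_integral_Ioc]
        refine (enorm_integral_le_lintegral_enorm _).trans (hSle _ n fun x hx => ?_)
        rw [hS n x hx]
        exact le_add_self
      have h3 : ‖∫ x in a..b, F' n x‖ₑ ≤ ENNReal.ofReal |H n a - H n b| + (S n a + S n b) := by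
        rw [hFTC n a ha b hb, hS n a ha, hS n b hb, ← Real.norm_eq_abs, ofReal_norm]
        calc ‖F n b - F n a‖ₑ = ‖(H n a - F n a) - (H n b - F n b) - (H n a - H n b)‖ₑ := by
              congr 1; ring
          _ ≤ ‖(H n a - F n a) - (H n b - F n b)‖ₑ + ‖H n a - H n b‖ₑ := enorm_sub_le
          _ ≤ (‖H n a - F n a‖ₑ + ‖H n b - F n b‖ₑ) + ‖H n a - H n b‖ₑ := by
              gcongr; exact enorm_sub_le
          _ = ‖H n a - H n b‖ₑ + (‖H n a - F n a‖ₑ + ‖H n b - F n b‖ₑ) := add_comm _ _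
          _ ≤ _ := by
              gcongr
              · exact le_self_add.trans (le_self_add)
              · exact le_self_add.trans (le_self_add)
      have h4 : ∫⁻ x in Icc a b, G n x ≤
          (∫⁻ x in Icc a b, ‖Q x‖ₑ) + ∫⁻ x in Icc 0 1, S n x := by
        calc ∫⁻ x in Icc a b, G n x
            ≤ ∫⁻ x in Icc a b, (‖Q x‖ₑ + ‖(G n x).toReal - Q x‖ₑ) := by
              refine lintegral_mono_ae ((ae_restrict_iff' measurableSet_Icc).2 ?_)
              filter_upwards [hGtop n] with x hx hxI
              have h5 : G n x = ‖(G n x).toReal‖ₑ := by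
                rw [Real.enorm_of_nonneg ENNReal.toReal_nonneg,
                  ENNReal.ofReal_toReal (hx (hsubset hxI)).ne]
              calc G n x = ‖Q x + ((G n x).toReal - Q x)‖ₑ := by rw [add_sub_cancel, ← h5]
                _ ≤ _ := enorm_add_le _ _
          _ = (∫⁻ x in Icc a b, ‖Q x‖ₑ) + ∫⁻ x in Icc a b, ‖(G n x).toReal - Q x‖ₑ := by
              refine lintegral_add_left' ?_ _
              exact ((intervalIntegrable_iff_integrableOn_Icc_of_le hab).1
                (hsub hQ a ha b hb)).aestronglyMeasurable.enorm
          _ ≤ _ := by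
              refine add_le_add le_rfl (hSle _ n fun x hx => ?_)
              rw [hS n x hx]
              exact le_self_add.trans' le_add_self
      calc ‖∫ x in a..b, V x‖ₑ ≤ _ := h1
        _ ≤ ENNReal.ofReal |H n a - H n b| + (S n a + S n b) + ∫⁻ x in Icc 0 1, S n x :=
            add_le_add h3 h2
        _ ≤ ((∫⁻ x in Icc a b, ‖Q x‖ₑ) + ∫⁻ x in Icc 0 1, S n x) + (S n a + S n b) +
            ∫⁻ x in Icc 0 1, S n x := by
            gcongr
            exact (hG n a ha b hb hab).trans h4
        _ = _ := by ring
    have hlim := ge_of_tendsto' (tendsto_const_nhds.add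
      (((hPa.add hPb).add hSint).add hSint)) hbound
    rw [hQint] at hlim
    simp only [add_zero] at hlim
    rw [← ofReal_norm] at hlim
    exact (ENNReal.ofReal_le_ofReal_iff
      (intervalIntegral.integral_nonneg hab fun x _ => abs_nonneg _)).1 hlim
  filter_upwards [hQ0, hmain] with x h1 h2 hx
  rw [← abs_of_nonneg (h1 hx)]
  exact h2 hx

/-! ### Passage from the product to its slices -/

/-- A sequence that tends to `0` in `L¹` of a product has a subsequence almost all of whose slices
tend to `0` both in `L¹` and almost everywhere. -/
lemma exists_subseq_tendsto_slices {X Y : Type*} [MeasurableSpace X] [MeasurableSpace Y]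
    {μ : Measure X} {ν : Measure Y} [SFinite μ] [SFinite ν] {S : ℕ → X × Y → ℝ≥0∞}
    (hS : ∀ n, AEMeasurable (S n) (μ.prod ν))
    (hlim : Tendsto (fun n => ∫⁻ p, S n p ∂(μ.prod ν)) atTop (𝓝 0)) :
    ∃ φ : ℕ → ℕ, StrictMono φ ∧ ∀ᵐ y ∂ν,
      Tendsto (fun n => ∫⁻ x, S (φ n) (x, y) ∂μ) atTop (𝓝 0) ∧
      ∀ᵐ x ∂μ, Tendsto (fun n => S (φ n) (x, y)) atTop (𝓝 0) := by
  -- The integrals along the subsequence are below 2⁻ⁿ, hence summable. Both the sum of the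
  -- functions and the sum of their slice integrals are then finite almost everywhere, and terms of
  -- a convergent series tend to 0.
  obtain ⟨φ, hφ, hle⟩ := extraction_forall_of_eventually
    (P := fun n k => ∫⁻ p, S k p ∂(μ.prod ν) < (2⁻¹ : ℝ≥0∞) ^ n) fun n =>
      hlim.eventually (gt_mem_nhds (ENNReal.pow_pos (by simp) n))
  refine ⟨φ, hφ, ?_⟩
  have hsum : ∑' n, ∫⁻ p, S (φ n) p ∂(μ.prod ν) ≠ ∞ := by
    refine ne_top_of_le_ne_top ?_ (ENNReal.tsum_le_tsum fun n => (hle n).le)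
    rw [ENNReal.tsum_geometric]
    simp
  have h1 : ∀ᵐ p ∂μ.prod ν, Tendsto (fun n => S (φ n) p) atTop (𝓝 0) := by
    rw [← lintegral_tsum fun n => hS (φ n)] at hsum
    filter_upwards [ae_lt_top' (AEMeasurable.tsum fun n => hS (φ n)) hsum] with p hp
    exact ENNReal.tendsto_atTop_zero_of_tsum_ne_top hp.ne
  have h1' : ∀ᵐ y ∂ν, ∀ᵐ x ∂μ, Tendsto (fun n => S (φ n) (x, y)) atTop (𝓝 0) := by
    have h2 : ∀ᵐ p ∂ν.prod μ, Tendsto (fun n => S (φ n) p.swap) atTop (𝓝 0) :=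
      Measure.measurePreserving_swap.quasiMeasurePreserving.ae h1
    exact Measure.ae_ae_of_ae_prod h2
  have hmeas : ∀ n, AEMeasurable (fun y => ∫⁻ x, S (φ n) (x, y) ∂μ) ν := fun n =>
    ((hS (φ n)).comp_quasiMeasurePreserving
      Measure.measurePreserving_swap.quasiMeasurePreserving).lintegral_prod_right'
  have h3 : ∀ᵐ y ∂ν, Tendsto (fun n => ∫⁻ x, S (φ n) (x, y) ∂μ) atTop (𝓝 0) := by
    have h4 : ∀ n, ∫⁻ p, S (φ n) p ∂(μ.prod ν) = ∫⁻ y, ∫⁻ x, S (φ n) (x, y) ∂μ ∂ν :=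
      fun n => lintegral_prod_symm _ (hS (φ n))
    simp only [h4] at hsum
    rw [← lintegral_tsum hmeas] at hsum
    filter_upwards [ae_lt_top' (AEMeasurable.tsum hmeas) hsum] with y hy
    exact ENNReal.tendsto_atTop_zero_of_tsum_ne_top hy.ne
  filter_upwards [h1', h3] with y h1 h3 using ⟨h3, h1⟩

lemma lintegral_unitInterval (F : unitInterval → ℝ≥0∞) :
    ∫⁻ x, F x = ∫⁻ x in Icc (0 : ℝ) 1, F (projIcc 0 1 zero_le_one x) := by
  rw [← lintegral_subtype_comap measurableSet_Icc]
  simp only [projIcc_val]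
  rfl

lemma ae_unitInterval_iff (P : unitInterval → Prop) : (∀ᵐ x, P x) ↔
    ∀ᵐ x : ℝ, x ∈ Icc (0 : ℝ) 1 → P (projIcc 0 1 zero_le_one x) := by
  rw [← ae_restrict_iff' measurableSet_Icc, ae_restrict_iff_subtype measurableSet_Icc]
  simp only [projIcc_val]
  rfl

lemma integrable_unitInterval_iff (F : unitInterval → ℝ) : Integrable F ↔
    IntervalIntegrable (fun x => F (projIcc 0 1 zero_le_one x)) volume 0 1 := by
  rw [intervalIntegrable_iff_integrableOn_Icc_of_le zero_le_one, IntegrableOn,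
    ← (measurePreserving_subtype_coe (μa := volume) (s := Icc (0 : ℝ) 1)
      measurableSet_Icc).integrable_comp_emb
      (MeasurableEmbedding.subtype_coe measurableSet_Icc)]
  have : (fun x => F (projIcc 0 1 zero_le_one x)) ∘ (Subtype.val : Icc (0 : ℝ) 1 → ℝ) = F :=
    funext fun x => by simp only [Function.comp_apply, projIcc_val]
  rw [this]
  rfl

variable (D) in
lemma integrable_comp_proj (u : L2 D) : Integrable (fun p => u (proj D p)) (prodMeasure D) :=
  (measurePreserving_proj D).integrable_comp_of_integrable
    ((Lp.memLp u).integrable one_le_two)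

variable (D) in
lemma ae_intervalIntegrable_slice (u : L2 D) : ∀ᵐ w ∂cantorMeasure D,
    IntervalIntegrable (fun x => u (proj D (projIcc 0 1 zero_le_one x, w))) volume 0 1 := by
  filter_upwards [(integrable_comp_proj D u).prod_left_ae] with w hw
  exact (integrable_unitInterval_iff fun x => u (proj D (x, w))).1 hw

variable (D) in
lemma ae_ae_of_ae_prodMeasure {P : unitInterval × cantor D → Prop} (h : ∀ᵐ p ∂prodMeasure D, P p) :
    ∀ᵐ w ∂cantorMeasure D, ∀ᵐ x : unitInterval, P (x, w) := by
  have h2 : ∀ᵐ p ∂(cantorMeasure D).prod (volume : Measure unitInterval), P p.swap :=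
    Measure.measurePreserving_swap.quasiMeasurePreserving.ae h
  exact Measure.ae_ae_of_ae_prod h2

/-- On a probability space the L¹ norm is at most the L² norm. -/
lemma tendsto_lintegral_enorm {F : ℕ → Space D → ℝ} (hF : ∀ n, AEStronglyMeasurable (F n) (mu D))
    (h : Tendsto (fun n => eLpNorm (F n) 2 (mu D)) atTop (𝓝 0)) :
    Tendsto (fun n => ∫⁻ q, ‖F n q‖ₑ ∂mu D) atTop (𝓝 0) := by
  refine tendsto_of_tendsto_of_tendsto_of_le_of_le tendsto_const_nhds h (fun n => zero_le)
    fun n => ?_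
  rw [← eLpNorm_one_eq_lintegral_enorm]
  exact eLpNorm_le_eLpNorm_of_exponent_le one_le_two (hF n)

/-- The derivative of an `L²`-limit of smooth functions is dominated by every generalized upper
gradient. -/
theorem abs_le_of_isGenUpperGradient {u v q : L2 D} {f : ℕ → C(Space D, ℝ)} {d : ℕ → L2 D}
    (hf : ∀ n, f n ∈ smoothClass D) (hd : ∀ n, IsSmoothXDeriv D (f n) (d n))
    (hfu : Tendsto (fun n => toL2 D (f n)) atTop (𝓝 u)) (hdv : Tendsto d atTop (𝓝 v))
    (hq : IsGenUpperGradient D u q) : ∀ᵐ x ∂mu D, |v x| ≤ q x := by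
  obtain ⟨h, g, hhg, hhu, hgq⟩ := hq
  have hf2 : ∀ n, MemLp (f n) 2 (mu D) := fun n =>
    (memLp_congr_ae (ContinuousMap.coeFn_toLp (mu D) (𝕜 := ℝ) (p := 2) (f n))).1 (Lp.memLp _)
  have hgm : ∀ n, AEStronglyMeasurable (fun x => (g n x).toReal) (mu D) := fun n =>
    (hhg n).2.2.1.ennreal_toReal.aestronglyMeasurable
  have hr : Tendsto (fun n => ∫⁻ x, ‖h n x - f n x‖ₑ ∂mu D) atTop (𝓝 0) := by
    refine tendsto_lintegral_enorm
      (fun n => (hhg n).1.aestronglyMeasurable.sub (hf2 n).aestronglyMeasurable) ?_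
    have h1 : Tendsto (fun n => eLpNorm (fun x => f n x - u x) 2 (mu D)) atTop (𝓝 0) := by
      have := (Lp.tendsto_Lp_iff_tendsto_eLpNorm' _ _).1 hfu
      refine this.congr fun n => eLpNorm_congr_ae ?_
      filter_upwards [ContinuousMap.coeFn_toLp (mu D) (𝕜 := ℝ) (p := 2) (f n)] with x hx
      rw [Pi.sub_apply, toL2, hx]
    have h2 := hhu.add h1
    rw [add_zero] at h2
    refine tendsto_of_tendsto_of_tendsto_of_le_of_le tendsto_const_nhds h2 (fun n => zero_le)
      fun n => ?_
    have h3 : (fun x => h n x - f n x) = (fun x => h n x - u x) - fun x => f n x - u x := by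
      funext x; simp
    rw [h3]
    exact eLpNorm_sub_le ((hhg n).1.aestronglyMeasurable.sub (Lp.aestronglyMeasurable u))
      ((hf2 n).aestronglyMeasurable.sub (Lp.aestronglyMeasurable u)) one_le_two
  have hg := tendsto_lintegral_enorm (fun n => (hgm n).sub (Lp.aestronglyMeasurable q)) hgq
  have hdv' := tendsto_lintegral_enorm
    (fun n => (Lp.aestronglyMeasurable (d n)).sub (Lp.aestronglyMeasurable v))
    ((Lp.tendsto_Lp_iff_tendsto_eLpNorm' _ _).1 hdv)
  set A : ℕ → Space D → ℝ≥0∞ := fun n x =>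
    ‖h n x - f n x‖ₑ + ‖(g n x).toReal - q x‖ₑ + ‖d n x - v x‖ₑ
  have hm1 : ∀ n, AEMeasurable (fun x => ‖h n x - f n x‖ₑ) (mu D) := fun n =>
    ((hhg n).1.aestronglyMeasurable.sub (hf2 n).aestronglyMeasurable).enorm
  have hm2 : ∀ n, AEMeasurable (fun x => ‖(g n x).toReal - q x‖ₑ) (mu D) := fun n =>
    ((hgm n).sub (Lp.aestronglyMeasurable q)).enorm
  have hm3 : ∀ n, AEMeasurable (fun x => ‖d n x - v x‖ₑ) (mu D) := fun n =>
    ((Lp.aestronglyMeasurable (d n)).sub (Lp.aestronglyMeasurable v)).enorm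
  have hAm : ∀ n, AEMeasurable (A n) (mu D) := fun n => ((hm1 n).add (hm2 n)).add (hm3 n)
  have hAlim : Tendsto (fun n => ∫⁻ x, A n x ∂mu D) atTop (𝓝 0) := by
    have := (hr.add hg).add hdv'
    simp only [add_zero] at this
    refine this.congr fun n => ?_
    exact ((lintegral_add_left' ((hm1 n).add (hm2 n)) _).trans
      (congrArg (· + _) (lintegral_add_left' (hm1 n) _))).symm
  -- `S n` agrees with `A n ∘ proj D` almost everywhere, but contains the genuine derivative in
  -- place of the class `d n`, so the fundamental theorem of calculus applies on every slice.
  set S : ℕ → unitInterval × cantor D → ℝ≥0∞ := fun n p =>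
    ‖h n (proj D p) - f n (proj D p)‖ₑ + ‖(g n (proj D p)).toReal - q (proj D p)‖ₑ +
      ‖deriv (hat D (f n) p.2) (p.1 : ℝ) - v (proj D p)‖ₑ
  have hSA : ∀ n, S n =ᵐ[prodMeasure D] A n ∘ proj D := fun n => by
    filter_upwards [hd n] with p hp
    simp only [S, A, Function.comp_apply, hp]
  have hSm : ∀ n, AEMeasurable (S n) (prodMeasure D) := fun n =>
    ((hAm n).comp_quasiMeasurePreserving
      (measurePreserving_proj D).quasiMeasurePreserving).congr (hSA n).symm
  have hSlim : Tendsto (fun n => ∫⁻ p, S n p ∂prodMeasure D) atTop (𝓝 0) := by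
    refine hAlim.congr fun n => ?_
    rw [lintegral_congr_ae (hSA n)]
    exact lintegral_map' (hAm n) (continuous_proj D).measurable.aemeasurable
  obtain ⟨φ, -, hφ⟩ := exists_subseq_tendsto_slices hSm hSlim
  -- Square integrability makes the upper gradients finite almost everywhere, so `toReal` loses
  -- nothing in the slice integrals.
  have hgtop : ∀ᵐ p ∂prodMeasure D, ∀ n, g n (proj D p) < ∞ := by
    refine (measurePreserving_proj D).quasiMeasurePreserving.ae
      (p := fun x => ∀ n, g n x < ∞) (ae_all_iff.2 fun n => ?_)
    filter_upwards [ae_lt_top ((hhg n).2.2.1.pow_const 2) (hhg n).2.1.ne] with x hx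
    by_contra hcon
    rw [not_lt, top_le_iff] at hcon
    simp [hcon] at hx
  have hslice : ∀ᵐ w ∂cantorMeasure D, ∀ᵐ x : unitInterval,
      |v (proj D (x, w))| ≤ q (proj D (x, w)) := by
    filter_upwards [hφ, ae_ae_of_ae_prodMeasure D hgtop, ae_intervalIntegrable_slice D v,
      ae_intervalIntegrable_slice D q] with w hw hgw hvw hqw
    rw [ae_unitInterval_iff]
    refine ae_abs_le_of_tendsto hvw hqw (F := fun n => hat D (f (φ n)) w)
      (F' := fun n => deriv (hat D (f (φ n)) w))
      (H := fun n x => h (φ n) (proj D (projIcc 0 1 zero_le_one x, w)))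
      (G := fun n x => g (φ n) (proj D (projIcc 0 1 zero_le_one x, w)))
      (S := fun n x => S (φ n) (projIcc 0 1 zero_le_one x, w))
      (fun n => intervalIntegrable_deriv_hat (hf _) w (by simp) (by simp))
      (fun n a ha b hb => integral_deriv_hat (hf _) w ha hb)
      (fun n a ha b hb hab => (hhg (φ n)).2.2.abs_sub_le w ha.1 hab hb.2) ?_ ?_ ?_ ?_
    · intro n
      filter_upwards [(ae_unitInterval_iff _).1 hgw] with x hx hxI using hx hxI (φ n)
    · intro n x hx
      simp only [S, projIcc_of_mem _ hx, hat_of_mem D _ _ hx]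
    · refine hw.1.congr fun n => ?_
      rw [lintegral_unitInterval]
    · exact (ae_unitInterval_iff _).1 hw.2
  refine ae_mu_of_ae_prod (measurableSet_le (Lp.stronglyMeasurable v).measurable.abs
    (Lp.stronglyMeasurable q).measurable) ?_
  -- Measurability of the set is what allows the slicewise statement to be reassembled into one on
  -- the product.
  have hmeas : MeasurableSet {p : cantor D × unitInterval |
      |v (proj D p.swap)| ≤ q (proj D p.swap)} := by
    have hp : Measurable fun p : cantor D × unitInterval => proj D p.swap :=
      (continuous_proj D).measurable.comp measurable_swap
    exact measurableSet_le ((Lp.stronglyMeasurable v).measurable.abs.comp hp)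
      ((Lp.stronglyMeasurable q).measurable.comp hp)
  have h2 : ∀ᵐ p ∂(cantorMeasure D).prod (volume : Measure unitInterval),
      |v (proj D p.swap)| ≤ q (proj D p.swap) :=
    (Measure.ae_prod_mem_iff_ae_ae_mem hmeas).2 hslice
  exact Measure.measurePreserving_swap.quasiMeasurePreserving.ae h2

/-! ### The closed graph of the derivative -/

lemma eLpNorm_two_eq {X : Type*} [MeasurableSpace X] {μ : Measure X} (f : X → ℝ) :
    eLpNorm f 2 μ = (∫⁻ x, ‖f x‖ₑ ^ 2 ∂μ) ^ (1 / 2 : ℝ) := by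
  rw [eLpNorm_eq_lintegral_rpow_enorm_toReal two_ne_zero ENNReal.ofNat_ne_top]
  simp

lemma lintegral_enorm_sq_lt_top {X : Type*} [MeasurableSpace X] {μ : Measure X} {f : X → ℝ}
    (h : MemLp f 2 μ) : ∫⁻ x, ‖f x‖ₑ ^ 2 ∂μ < ∞ := by
  have := lintegral_rpow_enorm_lt_top_of_eLpNorm_lt_top two_ne_zero ENNReal.ofNat_ne_top h.2
  simpa using this

variable (D) in
/-- The graph of `∂/∂x` on `𝒢` in `L² × L²`. -/
def smoothGraph : Submodule ℝ (L2 D × L2 D) where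
  carrier := {z | ∃ f ∈ smoothClass D, toL2 D f = z.1 ∧ IsSmoothXDeriv D f z.2}
  add_mem' := by
    rintro ⟨u, d⟩ ⟨v, e⟩ ⟨f, hf, hu, hd⟩ ⟨g, hg, hv, he⟩
    refine ⟨f + g, add_mem_smoothClass hf hg, ?_, hd.add hf hg he⟩
    simpa [toL2] using congrArg₂ (· + ·) hu hv
  zero_mem' := by
    have h : (0 : C(Space D, ℝ)) ∈ smoothClassAt D 0 := by
      refine mem_smoothClassAt_iff.2 ⟨fun _ _ _ _ => rfl, fun w a _ b _ _ _ => ?_⟩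
      have h0 : hat D 0 w = fun _ => (0 : ℝ) := rfl
      rw [h0]
      have h1 : deriv (fun _ : ℝ => (0 : ℝ)) = fun _ => 0 := by funext; simp
      exact ⟨contDiffOn_const, ⟨0, by rw [h1]; exact tendsto_const_nhds⟩,
        ⟨0, by rw [h1]; exact tendsto_const_nhds⟩⟩
    obtain ⟨d, hd⟩ := exists_isSmoothXDeriv (mem_iUnion.2 ⟨0, h⟩)
    -- Scaling any derivative of the zero function by 0 shows that its derivative is the zero class.
    have h' := hd.smul (mem_iUnion.2 ⟨0, h⟩) 0
    rw [zero_smul, zero_smul] at h'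
    exact ⟨0, mem_iUnion.2 ⟨0, h⟩, by simp [toL2], h'⟩
  smul_mem' := by
    rintro c ⟨u, d⟩ ⟨f, hf, hu, hd⟩
    refine ⟨c • f, smul_mem_smoothClass c hf, ?_, hd.smul hf c⟩
    simpa [toL2] using congrArg (c • ·) hu

variable (D) in
/-- The closure in `L² × L²` of the graph of `∂/∂x` on `𝒢`. -/
def closedGraph : Submodule ℝ (L2 D × L2 D) := (smoothGraph D).topologicalClosure

variable (D) in
lemma isClosed_closedGraph : IsClosed (closedGraph D : Set (L2 D × L2 D)) :=
  Submodule.isClosed_topologicalClosure _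

lemma mem_closedGraph_iff {u v : L2 D} : (u, v) ∈ closedGraph D ↔
    ∃ (f : ℕ → C(Space D, ℝ)) (d : ℕ → L2 D), (∀ n, f n ∈ smoothClass D) ∧
      (∀ n, IsSmoothXDeriv D (f n) (d n)) ∧ Tendsto (fun n => toL2 D (f n)) atTop (𝓝 u) ∧
      Tendsto d atTop (𝓝 v) := by
  rw [← SetLike.mem_coe, closedGraph, Submodule.topologicalClosure_coe, mem_closure_iff_seq_limit]
  constructor
  · rintro ⟨z, hz, hlim⟩
    choose f hf hfz hd using hz
    refine ⟨f, fun n => (z n).2, hf, hd, ?_, (continuous_snd.tendsto _).comp hlim⟩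
    simp only [hfz]
    exact (continuous_fst.tendsto _).comp hlim
  · rintro ⟨f, d, hf, hd, hu, hv⟩
    exact ⟨fun n => (toL2 D (f n), d n), fun n => ⟨f n, hf n, rfl, hd n⟩, hu.prodMk_nhds hv⟩

lemma mem_closedGraph_of_smooth {f : C(Space D, ℝ)} (hf : f ∈ smoothClass D) {d : L2 D}
    (hd : IsSmoothXDeriv D f d) : (toL2 D f, d) ∈ closedGraph D :=
  (smoothGraph D).le_topologicalClosure ⟨f, hf, rfl, hd⟩

/-- The minimal generalized upper gradient of an element of the closed graph. -/
theorem isMinGenUpperGradient_abs {u v : L2 D} (h : (u, v) ∈ closedGraph D) :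
    IsMinGenUpperGradient D u |v| := by
  obtain ⟨f, d, hf, hd, hfu, hdv⟩ := mem_closedGraph_iff.1 h
  refine ⟨?_, fun q hq => ?_⟩
  · choose g hg hgd using fun n => exists_isUpperGradient (hf n) (hd n)
    have hf2 : ∀ n, f n =ᵐ[mu D] toL2 D (f n) := fun n =>
      (ContinuousMap.coeFn_toLp (mu D) (𝕜 := ℝ) (p := 2) (f n)).symm
    refine ⟨fun n => f n, g, fun n => ⟨(memLp_congr_ae (hf2 n)).2 (Lp.memLp _), ?_, hg n⟩, ?_, ?_⟩
    · refine lt_of_eq_of_lt (lintegral_congr_ae ?_) (lintegral_enorm_sq_lt_top (Lp.memLp (d n)))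
      filter_upwards [hgd n] with x hx
      rw [hx, ← Real.norm_eq_abs, ofReal_norm]
    · refine ((Lp.tendsto_Lp_iff_tendsto_eLpNorm' _ _).1 hfu).congr fun n => eLpNorm_congr_ae ?_
      filter_upwards [hf2 n] with x hx
      rw [Pi.sub_apply, hx]
    · refine tendsto_of_tendsto_of_tendsto_of_le_of_le tendsto_const_nhds
        ((Lp.tendsto_Lp_iff_tendsto_eLpNorm' _ _).1 hdv) (fun n => zero_le) fun n => ?_
      refine eLpNorm_mono_ae ?_
      filter_upwards [hgd n, Lp.coeFn_abs v] with x hx hvx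
      rw [hx, hvx, ENNReal.toReal_ofReal (abs_nonneg _)]
      -- The reverse triangle inequality: d_n → v gives |d_n| → |v|.
      exact abs_abs_sub_abs_le_abs_sub _ _
  · filter_upwards [abs_le_of_isGenUpperGradient hf hd hfu hdv hq, Lp.coeFn_abs v] with x hx hvx
    rwa [hvx]

lemma IsMinGenUpperGradient.unique {u p p' : L2 D} (h : IsMinGenUpperGradient D u p)
    (h' : IsMinGenUpperGradient D u p') : p = p' := by
  refine Lp.ext ?_
  filter_upwards [h.2 p' h'.1, h'.2 p h.1] with x h1 h2 using le_antisymm h1 h2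

lemma IsUpperGradient.sub {f f' : Space D → ℝ} {g g' : Space D → ℝ≥0∞}
    (h : IsUpperGradient D f g) (h' : IsUpperGradient D f' g') :
    IsUpperGradient D (fun x => f x - f' x) (fun x => g x + g' x) := by
  refine ⟨h.1.add h'.1, fun l γ hγ => ?_⟩
  have hm : AEMeasurable (fun s => g (γ s)) (volume.restrict (Icc 0 l)) :=
    (h.1.comp_aemeasurable ((hγ.2.1.aemeasurable measurableSet_Icc)))
  rw [lintegral_add_left' hm]
  refine le_trans ?_ (add_le_add (h.2 l γ hγ) (h'.2 l γ hγ))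
  rw [← ENNReal.ofReal_add (abs_nonneg _) (abs_nonneg _)]
  refine ENNReal.ofReal_le_ofReal ?_
  calc |f (γ 0) - f' (γ 0) - (f (γ l) - f' (γ l))|
      = |(f (γ 0) - f (γ l)) - (f' (γ 0) - f' (γ l))| := by congr 1; ring
    _ ≤ _ := abs_sub _ _

lemma lintegral_add_sq_lt_top {X : Type*} [MeasurableSpace X] {μ : Measure X} {g g' : X → ℝ≥0∞}
    (hg : Measurable g) (h : ∫⁻ x, g x ^ 2 ∂μ < ∞) (h' : ∫⁻ x, g' x ^ 2 ∂μ < ∞) :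
    ∫⁻ x, (g x + g' x) ^ 2 ∂μ < ∞ := by
  have h1 : ∀ x, (g x + g' x) ^ 2 ≤ 2 * g x ^ 2 + 2 * g' x ^ 2 := by
    intro x
    have h2 := ENNReal.rpow_add_le_mul_rpow_add_rpow (g x) (g' x) (p := 2) (by norm_num)
    have h3 : (2 : ℝ) - 1 = 1 := by norm_num
    rw [h3, ENNReal.rpow_one, ENNReal.rpow_two, ENNReal.rpow_two, ENNReal.rpow_two] at h2
    rwa [mul_add] at h2
  refine (lintegral_mono h1).trans_lt ?_
  rw [lintegral_add_left ((hg.pow_const 2).const_mul 2), lintegral_const_mul' _ _ (by simp),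
    lintegral_const_mul' _ _ (by simp)]
  exact ENNReal.add_lt_top.2 ⟨ENNReal.mul_lt_top (by simp) h, ENNReal.mul_lt_top (by simp) h'⟩

lemma IsGenUpperGradient.sub {u u' p p' : L2 D} (h : IsGenUpperGradient D u p)
    (h' : IsGenUpperGradient D u' p') : IsGenUpperGradient D (u - u') (p + p') := by
  obtain ⟨f, g, hfg, hfu, hgp⟩ := h
  obtain ⟨f', g', hfg', hfu', hgp'⟩ := h'
  refine ⟨fun n x => f n x - f' n x, fun n x => g n x + g' n x, fun n =>
    ⟨(hfg n).1.sub (hfg' n).1,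
      lintegral_add_sq_lt_top (hfg n).2.2.1 (hfg n).2.1 (hfg' n).2.1,
      (hfg n).2.2.sub (hfg' n).2.2⟩, ?_, ?_⟩
  · have hlim := hfu.add hfu'
    rw [add_zero] at hlim
    refine tendsto_of_tendsto_of_tendsto_of_le_of_le tendsto_const_nhds hlim (fun n => zero_le)
      fun n => ?_
    refine le_trans (le_of_eq (eLpNorm_congr_ae ?_)) (eLpNorm_sub_le
      ((hfg n).1.aestronglyMeasurable.sub (Lp.aestronglyMeasurable u))
      ((hfg' n).1.aestronglyMeasurable.sub (Lp.aestronglyMeasurable u')) one_le_two)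
    filter_upwards [Lp.coeFn_sub u u'] with x hx
    simp only [hx, Pi.sub_apply]
    ring
  · have hlim := hgp.add hgp'
    rw [add_zero] at hlim
    refine tendsto_of_tendsto_of_tendsto_of_le_of_le tendsto_const_nhds hlim (fun n => zero_le)
      fun n => ?_
    -- Finiteness almost everywhere is needed for `toReal` to be additive.
    have hfin : ∀ {g : Space D → ℝ≥0∞}, Measurable g → ∫⁻ x, g x ^ 2 ∂mu D < ∞ →
        ∀ᵐ x ∂mu D, g x ≠ ∞ := by
      intro g hg hint
      filter_upwards [ae_lt_top (hg.pow_const 2) hint.ne] with x hx hcon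
      simp [hcon] at hx
    refine le_trans (le_of_eq (eLpNorm_congr_ae ?_)) (eLpNorm_add_le
      ((hfg n).2.2.1.ennreal_toReal.aestronglyMeasurable.sub (Lp.aestronglyMeasurable p))
      ((hfg' n).2.2.1.ennreal_toReal.aestronglyMeasurable.sub (Lp.aestronglyMeasurable p'))
      one_le_two)
    filter_upwards [Lp.coeFn_add p p', hfin (hfg n).2.2.1 (hfg n).2.1,
      hfin (hfg' n).2.2.1 (hfg' n).2.1] with x hx h1 h2
    simp only [hx, Pi.add_apply, ENNReal.toReal_add h1 h2]
    ring

lemma tendsto_toL2_of_tendstoSobolev {f : ℕ → C(Space D, ℝ)} {u : L2 D}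
    (h : TendstoSobolev D f u) : Tendsto (fun n => toL2 D (f n)) atTop (𝓝 u) := by
  obtain ⟨p, -, hp⟩ := h
  rw [tendsto_iff_norm_sub_tendsto_zero]
  refine squeeze_zero (fun n => norm_nonneg _) (fun n => ?_) hp
  rw [norm_sub_rev]
  exact le_add_of_nonneg_right (norm_nonneg _)

/-- Along a sequence in `𝒢` that converges in the graph norm the derivatives converge in `L²`. -/
theorem exists_tendsto_deriv {f : ℕ → C(Space D, ℝ)} {u : L2 D} (hf : ∀ n, f n ∈ smoothClass D)
    (h : TendstoSobolev D f u) {d : ℕ → L2 D} (hd : ∀ n, IsSmoothXDeriv D (f n) (d n)) :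
    ∃ v, Tendsto d atTop (𝓝 v) := by
  obtain ⟨p, hp, hlim⟩ := h
  have hp0 : Tendsto (fun n => ‖p n‖) atTop (𝓝 0) :=
    squeeze_zero (fun n => norm_nonneg _)
      (fun n => le_add_of_nonneg_left (norm_nonneg (u - toL2 D (f n)))) hlim
  have hbound : ∀ m n, dist (d m) (d n) ≤ ‖p m‖ + ‖p n‖ := by
    intro m n
    have h1 : (toL2 D (f m) - toL2 D (f n), d m - d n) ∈ closedGraph D :=
      (closedGraph D).sub_mem (mem_closedGraph_of_smooth (hf m) (hd m))
        (mem_closedGraph_of_smooth (hf n) (hd n))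
    -- Since f_m - f_n = (u - f_n) - (u - f_m), the sum p_n + p_m is a generalized upper gradient of
    -- it and so dominates its minimal one |d_m - d_n|.
    have h2 := (hp n).1.sub (hp m).1
    rw [sub_sub_sub_cancel_left] at h2
    have h3 := (isMinGenUpperGradient_abs h1).2 _ h2
    rw [dist_eq_norm, add_comm]
    refine le_trans (Lp.norm_le_norm_of_ae_le ?_) (norm_add_le _ _)
    filter_upwards [h3, Lp.coeFn_abs (d m - d n)] with x hx hx'
    rw [hx'] at hx
    exact hx.trans (le_abs_self _)
  refine cauchySeq_tendsto_of_complete (cauchySeq_iff_tendsto_dist_atTop_0.2 ?_)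
  rw [← prod_atTop_atTop_eq]
  refine squeeze_zero (fun _ => dist_nonneg) (fun z => hbound z.1 z.2) ?_
  simpa using (hp0.comp tendsto_fst).add (hp0.comp tendsto_snd)

/-- For a smooth sequence approximating (u, v), the minimal gradient of u - f_n is |v - d_n|.
Convergence of functions and derivatives in L² thus gives convergence in the graph norm, and the
other direction forgets structure. -/
theorem isXDeriv_iff {u v : L2 D} : IsXDeriv D u v ↔ (u, v) ∈ closedGraph D := by
  constructor
  · rintro ⟨f, d, hf, hfu, hd, hdv⟩
    exact mem_closedGraph_iff.2 ⟨f, d, hf, hd, tendsto_toL2_of_tendstoSobolev hfu, hdv⟩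
  · intro h
    obtain ⟨f, d, hf, hd, hfu, hdv⟩ := mem_closedGraph_iff.1 h
    refine ⟨f, d, hf, ⟨fun n => |v - d n|, fun n => isMinGenUpperGradient_abs
      ((closedGraph D).sub_mem h (mem_closedGraph_of_smooth (hf n) (hd n))), ?_⟩, hd, hdv⟩
    have h1 := (tendsto_const_nhds (x := u)).sub hfu
    have h2 := (tendsto_const_nhds (x := v)).sub hdv
    rw [sub_self] at h1 h2
    simpa [norm_abs_eq_norm] using h1.norm.add h2.norm

/-- Graph-norm convergence forces the derivatives to converge, so the closure of 𝒢 is the projection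
of the closed graph; membership in H^{1,2} comes for free from p_u = |v|. -/
theorem mem_domain_iff {u : L2 D} : u ∈ domain D ↔ ∃ v, (u, v) ∈ closedGraph D := by
  constructor
  · rintro ⟨-, f, hf, hfu⟩
    choose d hd using fun n => exists_isSmoothXDeriv (hf n)
    obtain ⟨v, hv⟩ := exists_tendsto_deriv hf hfu hd
    exact ⟨v, isXDeriv_iff.1 ⟨f, d, hf, hfu, hd, hv⟩⟩
  · rintro ⟨v, h⟩
    obtain ⟨f, d, hf, hfu, -⟩ := isXDeriv_iff.2 h
    exact ⟨⟨|v|, isMinGenUpperGradient_abs h⟩, f, hf, hfu⟩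

/-- The derivative is closable. -/
theorem closedGraph_unique {u v v' : L2 D} (h : (u, v) ∈ closedGraph D)
    (h' : (u, v') ∈ closedGraph D) : v = v' := by
  have h1 := (closedGraph D).sub_mem h h'
  rw [Prod.mk_sub_mk, sub_self] at h1
  -- Both |v - v'| and |0| are the minimal generalized upper gradient of 0.
  have h2 := (isMinGenUpperGradient_abs h1).unique
    (isMinGenUpperGradient_abs (closedGraph D).zero_mem)
  have h3 := congrArg norm h2
  rw [abs_zero, norm_abs_eq_norm, norm_zero, norm_eq_zero] at h3
  exact sub_eq_zero.1 h3

lemma xDeriv_eq {u v : L2 D} (h : (u, v) ∈ closedGraph D) : xDeriv D u = v := by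
  have hex : ∃ v, IsXDeriv D u v := ⟨v, isXDeriv_iff.2 h⟩
  rw [xDeriv, dif_pos hex]
  exact closedGraph_unique (isXDeriv_iff.1 hex.choose_spec) h

lemma mem_closedGraph_xDeriv {u : L2 D} (h : u ∈ domain D) : (u, xDeriv D u) ∈ closedGraph D := by
  obtain ⟨v, hv⟩ := mem_domain_iff.1 h
  rwa [xDeriv_eq hv]

lemma form_eq_inner (u v : L2 D) : form D u v = inner ℝ (xDeriv D u) (xDeriv D v) := by
  rw [L2.inner_def, form]
  refine integral_congr_ae (ae_of_all _ fun x => ?_)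
  simp [mul_comm]

lemma form_self_eq_norm (u : L2 D) : form D u u = ‖xDeriv D u‖ ^ 2 := by
  rw [form_eq_inner, real_inner_self_eq_norm_sq]

lemma xDeriv_add {u v : L2 D} (hu : u ∈ domain D) (hv : v ∈ domain D) :
    u + v ∈ domain D ∧ xDeriv D (u + v) = xDeriv D u + xDeriv D v := by
  have h := (closedGraph D).add_mem (mem_closedGraph_xDeriv hu) (mem_closedGraph_xDeriv hv)
  exact ⟨mem_domain_iff.2 ⟨_, h⟩, xDeriv_eq h⟩

lemma xDeriv_smul (c : ℝ) {u : L2 D} (hu : u ∈ domain D) :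
    c • u ∈ domain D ∧ xDeriv D (c • u) = c • xDeriv D u := by
  have h := (closedGraph D).smul_mem c (mem_closedGraph_xDeriv hu)
  exact ⟨mem_domain_iff.2 ⟨_, h⟩, xDeriv_eq h⟩

lemma xDeriv_sub {u v : L2 D} (hu : u ∈ domain D) (hv : v ∈ domain D) :
    u - v ∈ domain D ∧ xDeriv D (u - v) = xDeriv D u - xDeriv D v := by
  have h := (closedGraph D).sub_mem (mem_closedGraph_xDeriv hu) (mem_closedGraph_xDeriv hv)
  exact ⟨mem_domain_iff.2 ⟨_, h⟩, xDeriv_eq h⟩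

/-- The form `ℰ` is closed. -/
theorem exists_tendsto_form {u : ℕ → L2 D} (hu : ∀ n, u n ∈ domain D)
    (hc : ∀ ε > 0, ∃ N, ∀ m ≥ N, ∀ n ≥ N,
      form D (u m - u n) (u m - u n) + ‖u m - u n‖ ^ 2 < ε) :
    ∃ v ∈ domain D, Tendsto (fun n => form D (u n - v) (u n - v) + ‖u n - v‖ ^ 2) atTop (𝓝 0) := by
  have hE : ∀ m n, form D (u m - u n) (u m - u n) = ‖xDeriv D (u m) - xDeriv D (u n)‖ ^ 2 :=
    fun m n => by rw [form_self_eq_norm, (xDeriv_sub (hu m) (hu n)).2]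
  -- Cauchy for the form norm means that functions and derivatives are both Cauchy in L², and the
  -- graph is closed.
  have hcauchy : CauchySeq fun n => (u n, xDeriv D (u n)) := by
    rw [Metric.cauchySeq_iff]
    intro ε hε
    obtain ⟨N, hN⟩ := hc (ε ^ 2) (by positivity)
    refine ⟨N, fun m hm n hn => ?_⟩
    have h1 := hN m hm n hn
    rw [hE] at h1
    rw [Prod.dist_eq, dist_eq_norm, dist_eq_norm]
    refine max_lt ?_ ?_
    · exact lt_of_pow_lt_pow_left₀ 2 hε.le (by linarith [sq_nonneg ‖xDeriv D (u m) - xDeriv D (u n)‖])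
    · exact lt_of_pow_lt_pow_left₀ 2 hε.le (by linarith [sq_nonneg ‖u m - u n‖])
  obtain ⟨⟨v, x⟩, hlim⟩ := cauchySeq_tendsto_of_complete hcauchy
  have hmem : (v, x) ∈ closedGraph D := (isClosed_closedGraph D).mem_of_tendsto hlim
    (Eventually.of_forall fun n => mem_closedGraph_xDeriv (hu n))
  have hv : v ∈ domain D := mem_domain_iff.2 ⟨x, hmem⟩
  refine ⟨v, hv, ?_⟩
  have h1 : Tendsto (fun n => u n - v) atTop (𝓝 0) := by
    rw [← sub_self v]
    exact ((continuous_fst.tendsto _).comp hlim).sub tendsto_const_nhds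
  have h2 : Tendsto (fun n => xDeriv D (u n) - x) atTop (𝓝 0) := by
    rw [← sub_self x]
    exact ((continuous_snd.tendsto _).comp hlim).sub tendsto_const_nhds
  have h3 := (h2.norm.pow 2).add (h1.norm.pow 2)
  simp only [norm_zero, ne_eq, OfNat.ofNat_ne_zero, not_false_eq_true, zero_pow, add_zero] at h3
  refine h3.congr fun n => ?_
  rw [form_self_eq_norm, (xDeriv_sub (hu n) hv).2, xDeriv_eq hmem]

/-! ### Contractions operate on the form -/

/-- Dominated convergence in `L²`. -/
lemma tendsto_eLpNorm_two_of_dominated {X : Type*} [MeasurableSpace X] {μ : Measure X}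
    {F : ℕ → X → ℝ} {G : X → ℝ} (hF : ∀ n, AEStronglyMeasurable (F n) μ) (hG : MemLp G 2 μ)
    (hle : ∀ n, ∀ᵐ x ∂μ, |F n x| ≤ |G x|)
    (hlim : ∀ᵐ x ∂μ, Tendsto (fun n => F n x) atTop (𝓝 0)) :
    Tendsto (fun n => eLpNorm (F n) 2 μ) atTop (𝓝 0) := by
  have h1 : Tendsto (fun n => ∫⁻ x, ‖F n x‖ₑ ^ 2 ∂μ) atTop (𝓝 (∫⁻ _, 0 ∂μ)) := by
    refine tendsto_lintegral_of_dominated_convergence' (fun x => ‖G x‖ₑ ^ 2)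
      (fun n => (hF n).enorm.pow_const 2) (fun n => ?_) (lintegral_enorm_sq_lt_top hG).ne ?_
    · filter_upwards [hle n] with x hx
      gcongr
      rw [← ofReal_norm, ← ofReal_norm]
      exact ENNReal.ofReal_le_ofReal hx
    · filter_upwards [hlim] with x hx
      have h2 := (ENNReal.continuous_pow 2).tendsto _ |>.comp
        ((continuous_enorm.tendsto (0 : ℝ)).comp hx)
      simpa [Function.comp_def] using h2
  rw [lintegral_zero] at h1
  have h3 := (ENNReal.continuous_rpow_const (y := 1 / 2)).tendsto 0 |>.comp h1
  rw [ENNReal.zero_rpow_of_pos (by norm_num)] at h3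
  exact h3.congr fun n => (eLpNorm_two_eq _).symm

lemma abs_sub_le_of_abs_deriv_le_one {ψ : ℝ → ℝ} (hψ : ContDiff ℝ 1 ψ)
    (h : ∀ s, |deriv ψ s| ≤ 1) (s t : ℝ) : |ψ s - ψ t| ≤ |s - t| := by
  have := Convex.norm_image_sub_le_of_norm_deriv_le (f := ψ) (C := 1) (s := univ)
    (fun x _ => hψ.differentiable one_ne_zero x) (fun x _ => h x) convex_univ (mem_univ t)
    (mem_univ s)
  simpa using this

lemma memLp_mul_of_abs_le_one {X : Type*} [MeasurableSpace X] {μ : Measure X} {F G : X → ℝ}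
    (hF : AEStronglyMeasurable F μ) (h : ∀ x, |F x| ≤ 1) (hG : MemLp G 2 μ) :
    MemLp (fun x => F x * G x) 2 μ := by
  refine hG.of_le (hF.mul hG.aestronglyMeasurable) (ae_of_all _ fun x => ?_)
  rw [norm_mul]
  exact mul_le_of_le_one_left (norm_nonneg _) (h x)

/-- Almost everywhere convergence is needed in the chain rule, where ψ' is only continuous and L²
convergence of f_n does not pass through it directly. -/
lemma exists_seq_tendsto_ae_of_mem_closedGraph {u v : L2 D} (h : (u, v) ∈ closedGraph D) :
    ∃ (f : ℕ → C(Space D, ℝ)) (d : ℕ → L2 D), (∀ n, f n ∈ smoothClass D) ∧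
      (∀ n, IsSmoothXDeriv D (f n) (d n)) ∧ Tendsto (fun n => toL2 D (f n)) atTop (𝓝 u) ∧
      Tendsto d atTop (𝓝 v) ∧
      ∀ᵐ x ∂mu D, Tendsto (fun n => toL2 D (f n) x) atTop (𝓝 (u x)) := by
  obtain ⟨f, d, hf, hd, hfu, hdv⟩ := mem_closedGraph_iff.1 h
  obtain ⟨φ, hφ, hae⟩ := (tendstoInMeasure_of_tendsto_Lp hfu).exists_seq_tendsto_ae
  exact ⟨fun n => f (φ n), fun n => d (φ n), fun n => hf _, fun n => hd _,
    hfu.comp hφ.tendsto_atTop, hdv.comp hφ.tendsto_atTop, hae⟩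

/-- The chain rule for the closed derivative. -/
theorem comp_mem_closedGraph {u v U V : L2 D} (h : (u, v) ∈ closedGraph D) {ψ : ℝ → ℝ}
    (hψ : ContDiff ℝ 1 ψ) (hψ1 : ∀ s, |deriv ψ s| ≤ 1) (hU : ∀ᵐ x ∂mu D, U x = ψ (u x))
    (hV : ∀ᵐ x ∂mu D, V x = deriv ψ (u x) * v x) : (U, V) ∈ closedGraph D := by
  obtain ⟨f, d, hf, hd, hfu, hdv, hae⟩ := exists_seq_tendsto_ae_of_mem_closedGraph h
  have hψd : Continuous (deriv ψ) := hψ.continuous_deriv le_rfl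
  have hfc : ∀ g : C(Space D, ℝ), toL2 D g =ᵐ[mu D] g := fun g =>
    ContinuousMap.coeFn_toLp (mu D) (𝕜 := ℝ) (p := 2) g
  have hcm : ∀ n, AEStronglyMeasurable (fun x => deriv ψ (f n x)) (mu D) := fun n =>
    (hψd.comp (f n).continuous).measurable.aestronglyMeasurable
  have hcu : AEStronglyMeasurable (fun x => deriv ψ (u x)) (mu D) :=
    hψd.comp_aestronglyMeasurable (Lp.aestronglyMeasurable u)
  have hE : ∀ n, MemLp (fun x => deriv ψ (f n x) * d n x) 2 (mu D) := fun n =>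
    memLp_mul_of_abs_le_one (hcm n) (fun x => hψ1 _) (Lp.memLp (d n))
  refine mem_closedGraph_iff.2 ⟨fun n => postcomp hψ.continuous (f n), fun n => (hE n).toLp _,
    fun n => postcomp_mem_smoothClass (hf n) hψ,
    fun n => (hd n).postcomp (hf n) hψ (hE n).coeFn_toLp, ?_, ?_⟩
  · rw [tendsto_iff_norm_sub_tendsto_zero] at hfu ⊢
    refine squeeze_zero (fun n => norm_nonneg _) (fun n => Lp.norm_le_norm_of_ae_le ?_) hfu
    filter_upwards [hfc (f n), hfc (postcomp hψ.continuous (f n)), hU,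
      Lp.coeFn_sub (toL2 D (f n)) u, Lp.coeFn_sub (toL2 D (postcomp hψ.continuous (f n))) U]
      with x h1 h2 h3 h4 h5
    rw [h4, h5, Pi.sub_apply, Pi.sub_apply, h1, h2, h3]
    exact abs_sub_le_of_abs_deriv_le_one hψ hψ1 _ _
  · rw [Lp.tendsto_Lp_iff_tendsto_eLpNorm'] at hdv ⊢
    -- Split ψ'(f_n) d_n - ψ'(u) v into ψ'(f_n)(d_n - v), controlled by |ψ'| ≤ 1, and (ψ'(f_n) -
    -- ψ'(u)) v, which is dominated by 2|v| and tends to 0 almost everywhere.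
    have hdom : Tendsto (fun n => eLpNorm (fun x => (deriv ψ (f n x) - deriv ψ (u x)) * v x)
        2 (mu D)) atTop (𝓝 0) := by
      refine tendsto_eLpNorm_two_of_dominated (G := fun x => 2 * v x)
        (fun n => ((hcm n).sub hcu).mul (Lp.aestronglyMeasurable v))
        ((Lp.memLp v).const_mul 2) (fun n => ae_of_all _ fun x => ?_) ?_
      · rw [abs_mul, abs_mul, abs_two]
        refine mul_le_mul_of_nonneg_right ?_ (abs_nonneg _)
        refine (abs_sub _ _).trans ?_
        linarith [hψ1 (f n x), hψ1 (u x)]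
      · filter_upwards [hae, ae_all_iff.2 fun n => hfc (f n)] with x hx hfx
        simp only [hfx] at hx
        have h1 := (hψd.tendsto _).comp hx
        have h2 := (h1.sub_const (deriv ψ (u x))).mul_const (v x)
        simpa [Function.comp_def] using h2
    have hlim := hdv.add hdom
    rw [add_zero] at hlim
    refine tendsto_of_tendsto_of_tendsto_of_le_of_le tendsto_const_nhds hlim (fun n => zero_le)
      fun n => ?_
    have h1 : eLpNorm (⇑((hE n).toLp _) - ⇑V) 2 (mu D) = eLpNorm
        ((fun x => deriv ψ (f n x) * (d n x - v x)) +
          fun x => (deriv ψ (f n x) - deriv ψ (u x)) * v x) 2 (mu D) := by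
      refine eLpNorm_congr_ae ?_
      filter_upwards [(hE n).coeFn_toLp, hV] with x h1 h2
      rw [Pi.sub_apply, h1, h2, Pi.add_apply]
      ring
    rw [h1]
    have hsub := (Lp.aestronglyMeasurable (d n)).sub (Lp.aestronglyMeasurable v)
    refine (eLpNorm_add_le ((hcm n).mul hsub)
      (((hcm n).sub hcu).mul (Lp.aestronglyMeasurable v)) one_le_two).trans
      (add_le_add (eLpNorm_mono fun x => ?_) le_rfl)
    rw [Pi.mul_apply, norm_mul]
    exact mul_le_of_le_one_left (norm_nonneg _) (hψ1 _)

/-! ### Smooth approximation of the unit contraction -/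

/-- A smooth function close to `s ↦ (s ∨ 0) ∧ 1` for small `ε`. -/
def smoothClip (ε s : ℝ) : ℝ :=
  (√(s ^ 2 + ε ^ 2) - √((s - 1) ^ 2 + ε ^ 2) + (√(1 + ε ^ 2) - √(ε ^ 2))) / 2

/-- The derivative of `smoothClip`. -/
def smoothClipDeriv (ε s : ℝ) : ℝ :=
  (s / √(s ^ 2 + ε ^ 2) - (s - 1) / √((s - 1) ^ 2 + ε ^ 2)) / 2

lemma contDiff_smoothClip {ε : ℝ} (hε : 0 < ε) : ContDiff ℝ 1 (smoothClip ε) := by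
  have h : ∀ c : ℝ, ContDiff ℝ 1 fun s : ℝ => √((s - c) ^ 2 + ε ^ 2) := fun c =>
    (((contDiff_id.sub contDiff_const).pow 2).add contDiff_const).sqrt fun s => by
      have := sq_nonneg (s - c)
      have : 0 < ε ^ 2 := by positivity
      simp only [id]
      linarith
  have h0 := h 0
  simp only [sub_zero] at h0
  exact ((h0.sub (h 1)).add contDiff_const).div_const 2

lemma deriv_smoothClip {ε : ℝ} (hε : 0 < ε) (s : ℝ) :
    deriv (smoothClip ε) s = smoothClipDeriv ε s := by
  have h : ∀ c : ℝ, HasDerivAt (fun s : ℝ => √((s - c) ^ 2 + ε ^ 2))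
      ((s - c) / √((s - c) ^ 2 + ε ^ 2)) s := fun c => by
    have h1 : (s - c) ^ 2 + ε ^ 2 ≠ 0 := by positivity
    have h2 := ((((hasDerivAt_id s).sub_const c).pow 2).add_const (ε ^ 2)).sqrt h1
    refine h2.congr_deriv ?_
    simp only [id, Nat.cast_ofNat, Nat.add_one_sub_one, pow_one, mul_one]
    exact mul_div_mul_left _ _ two_ne_zero
  have h0 := h 0
  simp only [sub_zero] at h0
  exact (((h0.sub (h 1)).add_const (√(1 + ε ^ 2) - √(ε ^ 2))).div_const 2).deriv

lemma abs_div_sqrt_le_one (s ε : ℝ) : |s / √(s ^ 2 + ε ^ 2)| ≤ 1 := by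
  rw [abs_div, abs_of_nonneg (Real.sqrt_nonneg _)]
  refine div_le_one_of_le₀ ?_ (Real.sqrt_nonneg _)
  exact Real.abs_le_sqrt (by linarith [sq_nonneg ε])

lemma abs_smoothClipDeriv_le_one (ε s : ℝ) : |smoothClipDeriv ε s| ≤ 1 := by
  have h1 := abs_le.1 (abs_div_sqrt_le_one s ε)
  have h2 := abs_le.1 (abs_div_sqrt_le_one (s - 1) ε)
  rw [abs_le, smoothClipDeriv]
  constructor <;> linarith

/-- This normalization accounts for the constant in `smoothClip`. With the Lipschitz bound it yields
|`smoothClip ε s`| ≤ |s|, the domination used in L². -/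
lemma smoothClip_zero (ε : ℝ) : smoothClip ε 0 = 0 := by
  simp [smoothClip]

/-- This formula is the source of `smoothClip`, where each |s - c| is smoothed to √((s - c)² + ε²).
-/
lemma clip_eq (s : ℝ) : min (max s 0) 1 = (|s| - |s - 1| + 1) / 2 := by
  rcases le_total s 0 with h | h
  · rw [max_eq_right h, min_eq_left zero_le_one, abs_of_nonpos h, abs_of_nonpos (by linarith)]
    ring
  · rw [max_eq_left h, abs_of_nonneg h]
    rcases le_total s 1 with h' | h'
    · rw [min_eq_left h', abs_of_nonpos (by linarith)]
      ring
    · rw [min_eq_right h', abs_of_nonneg (by linarith)]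
      ring

/-- The pointwise limit of `smoothClipDeriv ε` as `ε → 0`. -/
def clipDeriv (s : ℝ) : ℝ := (s / |s| - (s - 1) / |s - 1|) / 2

lemma tendsto_sqrt_add_sq {ε : ℕ → ℝ} (hε : Tendsto ε atTop (𝓝 0)) (s : ℝ) :
    Tendsto (fun n => √(s + ε n ^ 2)) atTop (𝓝 √s) := by
  have h : Continuous fun e : ℝ => √(s + e ^ 2) := by fun_prop
  simpa [Function.comp_def] using (h.tendsto 0).comp hε

lemma tendsto_smoothClip {ε : ℕ → ℝ} (hε : Tendsto ε atTop (𝓝 0)) (s : ℝ) :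
    Tendsto (fun n => smoothClip (ε n) s) atTop (𝓝 (min (max s 0) 1)) := by
  have h1 := tendsto_sqrt_add_sq hε (s ^ 2)
  have h2 := tendsto_sqrt_add_sq hε ((s - 1) ^ 2)
  have h3 := tendsto_sqrt_add_sq hε 1
  have h4 := tendsto_sqrt_add_sq hε 0
  simp only [zero_add] at h4
  rw [Real.sqrt_sq_eq_abs] at h1 h2
  rw [Real.sqrt_one] at h3
  rw [Real.sqrt_zero] at h4
  have h5 := ((h1.sub h2).add (h3.sub h4)).div_const 2
  rw [sub_zero, ← clip_eq] at h5
  exact h5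

lemma tendsto_smoothClipDeriv {ε : ℕ → ℝ} (hε : Tendsto ε atTop (𝓝 0)) (s : ℝ) :
    Tendsto (fun n => smoothClipDeriv (ε n) s) atTop (𝓝 (clipDeriv s)) := by
  have h : ∀ s : ℝ, Tendsto (fun n => s / √(s ^ 2 + ε n ^ 2)) atTop (𝓝 (s / |s|)) := by
    intro s
    rcases eq_or_ne s 0 with rfl | hs
    -- At 0 all quotients vanish, in agreement with the convention 0 / 0 = 0 in `clipDeriv`.
    · simp
    · refine tendsto_const_nhds.div ?_ (abs_ne_zero.2 hs)
      rw [← Real.sqrt_sq_eq_abs]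
      exact tendsto_sqrt_add_sq hε (s ^ 2)
  exact ((h s).sub (h (s - 1))).div_const 2

/-- `clipDeriv` is `smoothClipDeriv` at ε = 0, and that bound holds for every ε. -/
lemma abs_clipDeriv_le_one (s : ℝ) : |clipDeriv s| ≤ 1 := by
  have h := abs_smoothClipDeriv_le_one 0 s
  simpa [smoothClipDeriv, clipDeriv, Real.sqrt_sq_eq_abs] using h

lemma measurable_clipDeriv : Measurable clipDeriv := by
  unfold clipDeriv
  fun_prop

lemma abs_clip_le (s : ℝ) : |min (max s 0) 1| ≤ |s| := by
  rw [abs_of_nonneg (le_min (le_max_right _ _) zero_le_one)]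
  exact (min_le_left _ _).trans (max_le (le_abs_self _) (abs_nonneg _))

/-- The unit contraction operates on `ℰ`. -/
theorem exists_clip {u : L2 D} (hu : u ∈ domain D) :
    ∃ v ∈ domain D, (v =ᵐ[mu D] fun x => min (max (u x) 0) 1) ∧ form D v v ≤ form D u u := by
  have h := mem_closedGraph_xDeriv hu
  set v := xDeriv D u
  set ε : ℕ → ℝ := fun n => 1 / ((n : ℝ) + 1)
  have hε : ∀ n, 0 < ε n := fun n => Nat.one_div_pos_of_nat
  have hε0 : Tendsto ε atTop (𝓝 0) := tendsto_one_div_add_atTop_nhds_zero_nat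
  have hum := Lp.aestronglyMeasurable u
  have hvm := Lp.aestronglyMeasurable v
  have hd1 : ∀ n s, |deriv (smoothClip (ε n)) s| ≤ 1 := fun n s => by
    rw [deriv_smoothClip (hε n)]
    exact abs_smoothClipDeriv_le_one _ _
  have hle : ∀ n s, |smoothClip (ε n) s| ≤ |s| := fun n s => by
    simpa [smoothClip_zero] using
      abs_sub_le_of_abs_deriv_le_one (contDiff_smoothClip (hε n)) (hd1 n) s 0
  have hcm : ∀ n, AEStronglyMeasurable (fun x => smoothClip (ε n) (u x)) (mu D) := fun n =>
    (contDiff_smoothClip (hε n)).continuous.comp_aestronglyMeasurable hum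
  have hdm : ∀ n, AEStronglyMeasurable (fun x => deriv (smoothClip (ε n)) (u x)) (mu D) := fun n =>
    ((contDiff_smoothClip (hε n)).continuous_deriv le_rfl).comp_aestronglyMeasurable hum
  have hUn : ∀ n, MemLp (fun x => smoothClip (ε n) (u x)) 2 (mu D) := fun n =>
    (Lp.memLp u).of_le (hcm n) (ae_of_all _ fun x => hle n _)
  have hVn : ∀ n, MemLp (fun x => deriv (smoothClip (ε n)) (u x) * v x) 2 (mu D) := fun n =>
    memLp_mul_of_abs_le_one (hdm n) (fun x => hd1 n _) (Lp.memLp v)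
  have hclip : Continuous fun s : ℝ => min (max s 0) 1 := by fun_prop
  have hUm : AEStronglyMeasurable (fun x => min (max (u x) 0) 1) (mu D) :=
    hclip.comp_aestronglyMeasurable hum
  have hU : MemLp (fun x => min (max (u x) 0) 1) 2 (mu D) :=
    (Lp.memLp u).of_le hUm (ae_of_all _ fun x => abs_clip_le _)
  have hcdm : AEStronglyMeasurable (fun x => clipDeriv (u x)) (mu D) :=
    (measurable_clipDeriv.comp_aemeasurable hum.aemeasurable).aestronglyMeasurable
  have hV : MemLp (fun x => clipDeriv (u x) * v x) 2 (mu D) :=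
    memLp_mul_of_abs_le_one hcdm (fun x => abs_clipDeriv_le_one _) (Lp.memLp v)
  have hmem : ∀ n, ((hUn n).toLp _, (hVn n).toLp _) ∈ closedGraph D := fun n =>
    comp_mem_closedGraph h (contDiff_smoothClip (hε n)) (hd1 n) (hUn n).coeFn_toLp
      (hVn n).coeFn_toLp
  have hlimU : Tendsto (fun n => (hUn n).toLp _) atTop (𝓝 (hU.toLp _)) := by
    rw [Lp.tendsto_Lp_iff_tendsto_eLpNorm'']
    refine tendsto_eLpNorm_two_of_dominated (G := fun x => 2 * u x)
      (fun n => (hcm n).sub hUm) ((Lp.memLp u).const_mul 2) (fun n => ae_of_all _ fun x => ?_)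
      (ae_of_all _ fun x => ?_)
    · rw [Pi.sub_apply, abs_mul, abs_two]
      refine (abs_sub _ _).trans ?_
      linarith [hle n (u x), abs_clip_le (u x)]
    · have h1 := (tendsto_smoothClip hε0 (u x)).sub_const (min (max (u x) 0) 1)
      rwa [sub_self] at h1
  have hlimV : Tendsto (fun n => (hVn n).toLp _) atTop (𝓝 (hV.toLp _)) := by
    rw [Lp.tendsto_Lp_iff_tendsto_eLpNorm'']
    refine tendsto_eLpNorm_two_of_dominated (G := fun x => 2 * v x)
      (fun n => ((hdm n).mul hvm).sub (hcdm.mul hvm)) ((Lp.memLp v).const_mul 2)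
      (fun n => ae_of_all _ fun x => ?_) (ae_of_all _ fun x => ?_)
    · rw [Pi.sub_apply, ← sub_mul, abs_mul, abs_mul, abs_two]
      refine mul_le_mul_of_nonneg_right ((abs_sub _ _).trans ?_) (abs_nonneg _)
      linarith [hd1 n (u x), abs_clipDeriv_le_one (u x)]
    · have h1 := ((tendsto_smoothClipDeriv hε0 (u x)).sub_const (clipDeriv (u x))).mul_const (v x)
      rw [sub_self, zero_mul] at h1
      refine h1.congr fun n => ?_
      rw [Pi.sub_apply, deriv_smoothClip (hε n), sub_mul]
  -- Closedness of the graph identifies the derivative of the clipped function as `clipDeriv (u x) *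
  -- v x`. No information on `v` where u equals 0 or 1 is needed, as |`clipDeriv`| ≤ 1 everywhere.
  have hmemU : (hU.toLp _, hV.toLp _) ∈ closedGraph D := (isClosed_closedGraph D).mem_of_tendsto
    (hlimU.prodMk_nhds hlimV) (Eventually.of_forall hmem)
  refine ⟨hU.toLp _, mem_domain_iff.2 ⟨_, hmemU⟩, hU.coeFn_toLp, ?_⟩
  rw [form_self_eq_norm, form_self_eq_norm, xDeriv_eq hmemU]
  refine pow_le_pow_left₀ (norm_nonneg _) (Lp.norm_le_norm_of_ae_le ?_) 2
  filter_upwards [hV.coeFn_toLp] with x hx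
  rw [hx, norm_mul]
  exact mul_le_of_le_one_left (norm_nonneg _) (abs_clipDeriv_le_one _)

/-! ### Density of the smooth class -/

variable (D) in
/-- The cell of level `n` of a point, as a subset of the Cantor set. -/
def cellAt (n : ℕ) (w : cantor D) : Set (cantor D) := {w' | SameCell D n w' w}

lemma cellAt_eq_of_sameCell {n : ℕ} {w w' : cantor D} (h : SameCell D n w w') :
    cellAt D n w = cellAt D n w' := by
  ext z
  exact ⟨fun hz => SameCell.trans hz h, fun hz => SameCell.trans hz h.symm⟩

variable (D) in
lemma isClopen_cellAt (n : ℕ) (w : cantor D) : IsClopen (cellAt D n w) :=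
  ⟨isClosed_sameCell D n w, isOpen_sameCell D n w⟩

variable (D) in
lemma isTopologicalBasis_cellAt :
    TopologicalSpace.IsTopologicalBasis {s | ∃ n w, s = cellAt D n w} := by
  refine TopologicalSpace.isTopologicalBasis_of_isOpen_of_nhds ?_ fun w V hw hV => ?_
  · rintro _ ⟨n, w, rfl⟩
    exact (isClopen_cellAt D n w).isOpen
  · have h1 : IsOpen (coding D ⁻¹' V) := hV.preimage (coding D).continuous
    have h2 : digits D w ∈ coding D ⁻¹' V := by
      rw [mem_preimage, digits, (coding D).apply_symm_apply]
      exact hw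
    obtain ⟨I, u, hu, hsub⟩ := isOpen_pi_iff.1 h1 _ h2
    -- The basic open set constrains only the digits in the finite set `I`; a cell of level beyond
    -- all of them fits inside.
    refine ⟨_, ⟨I.sup id + 1, w, rfl⟩, fun _ _ => rfl, fun z hz => ?_⟩
    have h3 : digits D z ∈ coding D ⁻¹' V := hsub fun i hi => by
      rw [hz i (Nat.lt_succ_of_le (Finset.le_sup (f := id) hi))]
      exact (hu i hi).2
    rwa [mem_preimage, digits, (coding D).apply_symm_apply] at h3

variable (D) in
-- Two cells are nested or disjoint.
lemma isPiSystem_cellAt : IsPiSystem {s | ∃ n w, s = cellAt D n w} := by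
  have key : ∀ m n w w', m ≤ n → (cellAt D m w ∩ cellAt D n w').Nonempty →
      cellAt D m w ∩ cellAt D n w' = cellAt D n w' := by
    rintro m n w w' hmn ⟨z, hz1, hz2⟩
    refine inter_eq_right.2 fun y hy => ?_
    exact SameCell.trans ((SameCell.trans hy (SameCell.symm hz2)).mono hmn) hz1
  rintro _ ⟨m, w, rfl⟩ _ ⟨n, w', rfl⟩ hne
  rcases le_total m n with h | h
  · exact ⟨n, w', key m n w w' h hne⟩
  · rw [inter_comm] at hne ⊢
    exact ⟨m, w, key n m w' w h hne⟩

/-- A π-λ argument: cells generate the Borel sets, and the cell of level 0 is all of K, which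
handles complements. -/
lemma ae_eq_zero_of_integral_cellAt {ν : Measure (cantor D)} [IsFiniteMeasure ν]
    {f : cantor D → ℝ} (hf : Integrable f ν) (h : ∀ n w, ∫ z in cellAt D n w, f z ∂ν = 0) :
    f =ᵐ[ν] 0 := by
  have hgen : borel (cantor D) = MeasurableSpace.generateFrom {s | ∃ n w, s = cellAt D n w} :=
    (isTopologicalBasis_cellAt D).borel_eq_generateFrom
  have huniv : ∫ z, f z ∂ν = 0 := by
    have w : cantor D := ⟨_, mem_range_self fun _ => false⟩
    have h0 : cellAt D 0 w = univ := eq_univ_of_forall fun z i hi => absurd hi (Nat.not_lt_zero i)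
    rw [← setIntegral_univ, ← h0, h]
  refine hf.ae_eq_zero_of_forall_setIntegral_eq_zero fun s hs _ => ?_
  rw [BorelSpace.measurable_eq (α := cantor D)] at hs
  induction s, hs using MeasurableSpace.induction_on_inter hgen (isPiSystem_cellAt D) with
  | empty => simp
  | basic s hs =>
    obtain ⟨n, w, rfl⟩ := hs
    exact h n w
  | compl s hs ih =>
    rw [← BorelSpace.measurable_eq (α := cantor D)] at hs
    have := integral_add_compl hs hf
    rwa [ih (measure_lt_top _ _), zero_add, huniv] at this
  | iUnion s hd hs ih =>
    rw [← BorelSpace.measurable_eq (α := cantor D)] at hs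
    rw [integral_iUnion hs hd hf.integrableOn]
    simp [fun i => ih i (measure_lt_top _ _)]

lemma indicator_cellAt_eq {n : ℕ} {w z z' : cantor D} (h : SameCell D n z z') :
    (cellAt D n w).indicator (fun _ => (1 : ℝ)) z = (cellAt D n w).indicator (fun _ => 1) z' := by
  by_cases hz : z ∈ cellAt D n w
  · rw [indicator_of_mem hz, indicator_of_mem (h.symm.trans hz)]
  · rw [indicator_of_notMem hz, indicator_of_notMem fun h' => hz (h.trans h')]

/-- The function `φ(x) 1_A(w)` for a cell `A` of level `n` and a function `φ` vanishing at the nodes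
of level `n`, as a continuous function on `L`. -/
def testFun {n : ℕ} {φ : ℝ → ℝ} (hφ : Continuous φ) (h0 : ∀ x ∈ nodes D n, φ x = 0)
    (w : cantor D) : C(Space D, ℝ) where
  toFun := lift D (fun p => φ p.1 * (cellAt D n w).indicator (fun _ => 1) p.2) fun p q h => by
    rw [← fst_eq_of_glued D h]
    by_cases hp : (p.1 : ℝ) ∈ nodes D n
    · rw [h0 _ hp, zero_mul, zero_mul]
    · rw [indicator_cellAt_eq (h.sameCell hp)]
  continuous_toFun := by
    refine (isQuotientMap_proj D).continuous_iff.2 ?_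
    exact (hφ.comp (continuous_subtype_val.comp continuous_fst)).mul
      ((continuous_const.indicator (by simp [(isClopen_cellAt D n w).frontier_eq])).comp continuous_snd)

lemma testFun_proj {n : ℕ} {φ : ℝ → ℝ} (hφ : Continuous φ) (h0 : ∀ x ∈ nodes D n, φ x = 0)
    (w : cantor D) (p : unitInterval × cantor D) :
    testFun hφ h0 w (proj D p) = φ p.1 * (cellAt D n w).indicator (fun _ => 1) p.2 := rfl

lemma testFun_mem_smoothClass {n : ℕ} {φ : ℝ → ℝ} (hφ : ContDiff ℝ 1 φ)
    (h0 : ∀ x ∈ nodes D n, φ x = 0) (w : cantor D) :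
    testFun hφ.continuous h0 w ∈ smoothClass D := by
  refine mem_iUnion.2 ⟨n, mem_smoothClassAt_iff.2 ⟨fun z z' hz x => ?_, fun z a ha b hb hab _ => ?_⟩⟩
  · rw [testFun_proj, testFun_proj]
    rw [indicator_cellAt_eq hz]
  · set c : ℝ := (cellAt D n w).indicator (fun _ => 1) z
    have heq : EqOn (hat D (testFun hφ.continuous h0 w) z) (fun x => φ x * c) (Ioo a b) := by
      intro x hx
      have hx1 : x ∈ Icc (0 : ℝ) 1 :=
        ⟨(nodes_subset_Icc D n ha).1.trans hx.1.le, hx.2.le.trans (nodes_subset_Icc D n hb).2⟩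
      rw [hat_of_mem D _ _ hx1, testFun_proj]
    have hcd : Continuous fun x => deriv φ x * c :=
      (hφ.continuous_deriv le_rfl).mul continuous_const
    refine IsPiece.of_deriv_eq hab ((hφ.mul contDiff_const).contDiffOn.congr heq)
      (g := fun x => deriv φ x * c) (fun x hx => ?_)
      ⟨_, (hcd.tendsto a).mono_left nhdsWithin_le_nhds⟩
      ⟨_, (hcd.tendsto b).mono_left nhdsWithin_le_nhds⟩
    rw [(heq.eventuallyEq_of_mem (isOpen_Ioo.mem_nhds hx)).deriv_eq]
    exact deriv_mul_const (hφ.differentiable one_ne_zero x) c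

lemma integral_unitInterval (F : unitInterval → ℝ) :
    ∫ x, F x = ∫ x in Icc (0 : ℝ) 1, F (projIcc 0 1 zero_le_one x) := by
  rw [← integral_subtype_comap measurableSet_Icc]
  simp only [projIcc_val]
  rfl

/-- Testing against φ(x) 1_A(w) and applying Fubini gives ∫ φ(x) ∫_A u(x, ·) dν dx = 0, and the
fundamental lemma of the calculus of variations concludes. -/
lemma ae_integral_cellAt_eq_zero {u : L2 D}
    (hu : ∀ f ∈ smoothClass D, ∫ p, f (proj D p) * u (proj D p) ∂prodMeasure D = 0) (n : ℕ)
    (w : cantor D) :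
    ∀ᵐ x : unitInterval, ∫ z in cellAt D n w, u (proj D (x, z)) ∂cantorMeasure D = 0 := by
  set A : unitInterval → ℝ := fun x => ∫ z in cellAt D n w, u (proj D (x, z)) ∂cantorMeasure D
  set χ : cantor D → ℝ := (cellAt D n w).indicator fun _ => 1
  have hcell := (isClopen_cellAt D n w).isOpen.measurableSet
  have hA : ∀ x, A x = ∫ z, χ z * u (proj D (x, z)) ∂cantorMeasure D := by
    intro x
    simp only [A]
    rw [← integral_indicator hcell]
    refine integral_congr_ae (ae_of_all _ fun z => ?_)
    by_cases hz : z ∈ cellAt D n w <;> simp [χ, hz]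
  have hχm : Measurable χ := measurable_const.indicator hcell
  have hχ1 : ∀ z, ‖χ z‖ ≤ 1 := fun z => by
    by_cases hz : z ∈ cellAt D n w <;> simp [χ, hz]
  have hint : Integrable (fun p : unitInterval × cantor D => χ p.2 * u (proj D p))
      (prodMeasure D) :=
    (integrable_comp_proj D u).bdd_mul (c := 1) (hχm.comp measurable_snd).aestronglyMeasurable
      (ae_of_all _ fun p => hχ1 p.2)
  have hAint : Integrable A := by
    have := hint.integral_prod_left
    simpa only [← hA] using this
  have hAR : IntegrableOn (fun x => A (projIcc 0 1 zero_le_one x)) (Icc 0 1) :=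
    (intervalIntegrable_iff_integrableOn_Icc_of_le zero_le_one).1
      ((integrable_unitInterval_iff A).1 hAint)
  -- Test functions supported in `U` vanish at all nodes of level n, which is what lets the product
  -- with the cell indicator descend to L.
  set U : Set ℝ := Ioo 0 1 \ nodes D n
  have hUopen : IsOpen U := isOpen_Ioo.sdiff (finite_nodes D n).isClosed
  have hUI : U ⊆ Icc 0 1 := sdiff_subset.trans Ioo_subset_Icc_self
  have hzero := hUopen.ae_eq_zero_of_integral_contDiff_smul_eq_zero (μ := volume)
    (hAR.mono_set hUI).locallyIntegrableOn (fun φ hφ _ hsupp => by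
      have hφ1 : ContDiff ℝ 1 φ := hφ.of_le (by exact_mod_cast le_top)
      have hout : ∀ x ∉ U, φ x = 0 := fun x hx => by
        by_contra hne
        exact hx (hsupp (subset_tsupport φ hne))
      have h0 : ∀ x ∈ nodes D n, φ x = 0 := fun x hx => hout x fun h => h.2 hx
      have h1 := hu _ (testFun_mem_smoothClass hφ1 h0 w)
      obtain ⟨C, hC⟩ := isCompact_Icc.exists_bound_of_continuousOn
        (s := Icc (0 : ℝ) 1) hφ.continuous.continuousOn
      have hint2 : Integrable (fun p : unitInterval × cantor D =>
          φ p.1 * (χ p.2 * u (proj D p))) (prodMeasure D) :=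
        hint.bdd_mul (c := C) (hφ.continuous.measurable.comp
          (measurable_subtype_coe.comp measurable_fst)).aestronglyMeasurable
          (ae_of_all _ fun p => hC _ p.1.2)
      simp only [testFun_proj, mul_assoc] at h1
      rw [integral_prod _ hint2] at h1
      simp only [integral_const_mul, ← hA] at h1
      rw [integral_unitInterval fun x => φ x * A x] at h1
      rw [← setIntegral_eq_integral_of_forall_compl_eq_zero (s := Icc 0 1)]
      · refine Eq.trans ?_ h1
        refine setIntegral_congr_fun measurableSet_Icc fun x hx => ?_
        simp only [smul_eq_mul, projIcc_of_mem _ hx]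
      · intro x hx
        rw [hout x fun h => hx (hUI h), zero_smul])
  rw [ae_unitInterval_iff]
  filter_upwards [hzero, ae_notMem_nodes D n] with x hx hxn hxI
  refine hx ⟨⟨lt_of_le_of_ne hxI.1 fun h => hxn ?_, lt_of_le_of_ne hxI.2 fun h => hxn ?_⟩, hxn⟩
  · rw [← h]; exact zero_mem_nodes D n
  · rw [h]; exact one_mem_nodes D n

/-- Each level has finitely many cells, so one null set of x serves all cells at once; outside it
the slice over x integrates to 0 on every cell and so vanishes. -/
theorem eq_zero_of_integral_smooth_eq_zero {u : L2 D}
    (hu : ∀ f ∈ smoothClass D, ∫ p, f (proj D p) * u (proj D p) ∂prodMeasure D = 0) : u = 0 := by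
  have h1 : ∀ᵐ x : unitInterval, ∀ n w,
      ∫ z in cellAt D n w, u (proj D (x, z)) ∂cantorMeasure D = 0 := by
    rw [ae_all_iff]
    intro n
    obtain ⟨S, hS, hcov⟩ := exists_finite_sameCell D n
    filter_upwards [(ae_ball_iff hS.countable).2 fun w _ => ae_integral_cellAt_eq_zero hu n w]
      with x hx w
    obtain ⟨w', hw', hc⟩ := hcov w
    rw [cellAt_eq_of_sameCell hc]
    exact hx w' hw'
  have hmeas : MeasurableSet {p : unitInterval × cantor D | u (proj D p) = 0} :=
    measurableSet_eq_fun ((Lp.stronglyMeasurable u).measurable.comp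
      (continuous_proj D).measurable) measurable_const
  have h2 : ∀ᵐ p ∂prodMeasure D, u (proj D p) = 0 := by
    refine (Measure.ae_prod_mem_iff_ae_ae_mem hmeas).2 ?_
    filter_upwards [h1, (integrable_comp_proj D u).prod_right_ae] with x hx hint
    exact ae_eq_zero_of_integral_cellAt hint hx
  refine Lp.ext ?_
  filter_upwards [ae_mu_of_ae_prod (measurableSet_eq_fun (Lp.stronglyMeasurable u).measurable
    measurable_const) h2, Lp.coeFn_zero ℝ 2 (mu D)] with x hx hx0
  rw [hx, hx0]
  rfl

variable (D) in
-- The classes of functions of 𝒢 form a subspace of the domain whose orthogonal complement is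
-- trivial.
theorem dense_domain : Dense (domain D) := by
  set M : Submodule ℝ (L2 D) := (smoothGraph D).map (LinearMap.fst ℝ _ _)
  have hM : ∀ f ∈ smoothClass D, toL2 D f ∈ M := fun f hf => by
    obtain ⟨d, hd⟩ := exists_isSmoothXDeriv hf
    exact ⟨(toL2 D f, d), ⟨f, hf, rfl, hd⟩, rfl⟩
  have hMd : (M : Set (L2 D)) ⊆ domain D := by
    rintro _ ⟨⟨u, d⟩, hz, rfl⟩
    exact mem_domain_iff.2 ⟨d, (smoothGraph D).le_topologicalClosure hz⟩
  refine Dense.mono hMd ?_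
  rw [Submodule.dense_iff_topologicalClosure_eq_top, Submodule.topologicalClosure_eq_top_iff,
    Submodule.eq_bot_iff]
  intro u hu
  refine eq_zero_of_integral_smooth_eq_zero fun f hf => ?_
  have h1 := (Submodule.mem_orthogonal _ _).1 hu _ (hM f hf)
  rw [L2.inner_def] at h1
  have hfc : toL2 D f =ᵐ[mu D] f := ContinuousMap.coeFn_toLp (mu D) (𝕜 := ℝ) (p := 2) f
  have h2 : ∫ x, f x * u x ∂mu D = 0 := by
    rw [← h1]
    refine integral_congr_ae ?_
    filter_upwards [hfc] with x hx
    rw [hx]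
    simp [mul_comm]
  rw [← h2]
  exact (integral_map (f := fun x => f x * u x) (continuous_proj D).measurable.aemeasurable
    (f.continuous.aestronglyMeasurable.mul (Lp.aestronglyMeasurable u))).symm

/-! ### Assembly of the two claims -/

variable (D) in
theorem existsUnique_isXDeriv_and_form_self {u : L2 D} (hu : u ∈ domain D) :
    (∃! v, IsXDeriv D u v) ∧
    ∃ p v, IsMinGenUpperGradient D u p ∧ IsXDeriv D u v ∧
      form D u u = ∫ x, p x ^ 2 ∂mu D ∧ form D u u = ∫ x, v x ^ 2 ∂mu D := by
  have h := mem_closedGraph_xDeriv hu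
  have hform : form D u u = ∫ x, xDeriv D u x ^ 2 ∂mu D := by
    simp only [form, sq]
  refine ⟨⟨xDeriv D u, isXDeriv_iff.2 h, fun v hv => closedGraph_unique (isXDeriv_iff.1 hv) h⟩,
    |xDeriv D u|, xDeriv D u, isMinGenUpperGradient_abs h, isXDeriv_iff.2 h, ?_, hform⟩
  rw [hform]
  refine integral_congr_ae ?_
  filter_upwards [Lp.coeFn_abs (xDeriv D u)] with x hx
  rw [hx, sq_abs]

variable (D) in
theorem isDirichletForm_form : IsDirichletForm (mu D) (domain D) (form D) where
  zero_mem := mem_domain_iff.2 ⟨0, (closedGraph D).zero_mem⟩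
  add_mem u hu v hv := (xDeriv_add hu hv).1
  smul_mem c u hu := (xDeriv_smul c hu).1
  dense := dense_domain D
  add_left u hu v hv w _ := by
    simp only [form_eq_inner, (xDeriv_add hu hv).2, inner_add_left]
  smul_left c u hu v _ := by
    simp only [form_eq_inner, (xDeriv_smul c hu).2, real_inner_smul_left]
  symm u _ v _ := by
    rw [form_eq_inner, form_eq_inner, real_inner_comm]
  nonneg u _ := by
    rw [form_self_eq_norm]
    positivity
  closed u hu hc := exists_tendsto_form hu hc
  markov u hu := exists_clip hu

end LaaksoSpace

end

theorem mainTheorem3 (D : LaaksoSpace.Data) :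
    (∀ u ∈ LaaksoSpace.domain D,
      (∃! v, LaaksoSpace.IsXDeriv D u v) ∧
      ∃ p v, LaaksoSpace.IsMinGenUpperGradient D u p ∧ LaaksoSpace.IsXDeriv D u v ∧
        LaaksoSpace.form D u u = ∫ x, p x ^ 2 ∂(LaaksoSpace.mu D) ∧
        LaaksoSpace.form D u u = ∫ x, v x ^ 2 ∂(LaaksoSpace.mu D)) ∧
    IsDirichletForm (LaaksoSpace.mu D) (LaaksoSpace.domain D) (LaaksoSpace.form D) :=
  ⟨fun _ hu => LaaksoSpace.existsUnique_isXDeriv_and_form_self D hu,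
    LaaksoSpace.isDirichletForm_form D⟩
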